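/- Let $m\ge 2$ and let $O_1,\dots,O_N$ be compact strictly convex subsets of $\mathbb R^m$ with non-empty interior and $C^2$ boundary, each of diameter less than $\sqrt2/4$, pairwise disjoint and contained in $(0,1)^m$. Assume that for each coordinate $i$ and all $r\ne r'$ the projections of $O_r$ and $O_{r'}$ to the $i$-th coordinate axis are disjoint, and that the convex hull of the union of any two of the $O_r$ is disjoint from every other $O_t$. For $k\in\mathbb Z^m$ put $O_{(k,r)}=O_r+k$, and let $\Omega$ be the closure of $\mathbb R^m\setminus\bigcup_{k,r}O_{(k,r)}$. An obstacle is said to be *between* two others $O_{(i,s)}$ and $O_{(j,t)}$ if it is different from both of them and has a common point with the convex hull of $O_{(i,s)}\cup O_{(j,t)}$. A sequence $(k_n,r_n)_{n=0}^p$, $p\le\infty$, in $\mathbb Z^m\times\{1,\dots,N\}$ is *admissible* if 1. $k_0=0$; 2. $(k_{n+1},r_{n+1})\neq(k_n,r_n)$ for all $n<p$; 3. for all $n<p$, no obstacle is between $O_{(k_n,r_n)}$ and $O_{(k_{n+1},r_{n+1})}$; 4. for all $n<p-1$, $O_{(k_{n+1},r_{n+1})}$ is not between $O_{(k_n,r_n)}$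 and $O_{(k_{n+2},r_{n+2})}$. A *trajectory (piece) of type* $(k_n,r_n)_{n=0}^p$ is a billiard path in $\Omega$ given by points $x_n\in\partial O_{(k_n,r_n)}$ ($0\le n\le p$, $n<\infty$) such that each segment $[x_n,x_{n+1}]$ lies in $\Omega$ and, at each $x_n$ with $0<n<p$, the path is reflected from $O_{(k_n,r_n)}$ with angle of incidence equal to angle of reflection. For finite $p$, the length of such a piece $T$ is $|T|=\sum_{n<p}\|x_{n+1}-x_n\|$ and its displacement is the vector $d(T)=x_p-x_0$. The *admissible rotation set* $AR\subset\mathbb R^m$ is the set of all limit points of sequences $\big(d(T_n)/|T_n|\big)_{n\ge1}$, where the $T_n$ are trajectory pieces of finite admissible types with $|T_n|\to\infty$. A trajectory $(x_n)_{n\ge0}$ of infinite type is *periodic* (on the torus $\mathbb R^m/\mathbb Z^m$) if there are $q\ge1$ and $k\in\mathbb Z^m$ with $x_{n+q}=x_n+k$ for all $n$. The *rotation vector* of a trajectory $(x_n)_{n\ge0}$ is $\lim_{n\to\infty}(x_n-x_0)\big/\sum_{j<n}\|x_{j+1}-x_j\|$, when the limit exists. **Theorem.** The rotation vectors of the periodic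 trajectories of (infinite) admissible type form a dense subset of the admissible rotation set: they belong to $AR$, and every element of $AR$ is a limit of such rotation vectors. -/

import Mathlib

open Set Filter Topology

noncomputable section

namespace TorusBilliard

/-- The universal covering `ℝ^m` of the torus `ℝ^m / ℤ^m`, with its Euclidean structure. -/
abbrev Space (m : ℕ) : Type := EuclideanSpace ℝ (Fin m)

/-- The integer vector `k`, seen as a vector of `ℝ^m`. -/
def latticeVec {m : ℕ} (k : Fin m → ℤ) : Space m :=
  WithLp.toLp 2 (fun i => (k i : ℝ))

/-- The boundary of `S` is of class `C²`: near each of its boundary points, `S` is the sublevel set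
`{g ≤ 0}` of a `C²` function whose differential does not vanish at that point. -/
def HasC2Boundary {m : ℕ} (S : Set (Space m)) : Prop :=
  ∀ x ∈ frontier S, ∃ U : Set (Space m), IsOpen U ∧ x ∈ U ∧ ∃ g : Space m → ℝ,
    ContDiffOn ℝ 2 g U ∧ fderiv ℝ g x ≠ 0 ∧ S ∩ U = {y | y ∈ U ∧ g y ≤ 0}

/-- The standing assumptions on the obstacles `O 0, …, O (N - 1)` of a fundamental cube. -/
structure IsObstacleFamily {m N : ℕ} (O : Fin N → Set (Space m)) : Prop where
  /-- The obstacles are strictly convex bodies … -/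
  isCompact : ∀ r, IsCompact (O r)
  interior_nonempty : ∀ r, (interior (O r)).Nonempty
  strictConvex : ∀ r, StrictConvex ℝ (O r)
  /-- … with `C²` boundary, … -/
  c2_boundary : ∀ r, HasC2Boundary (O r)
  /-- … of diameter less than `√2 / 4`, … -/
  diam_lt : ∀ r, Metric.diam (O r) < Real.sqrt 2 / 4
  /-- … contained in the interior of the unit cube, … -/
  mem_cube : ∀ r, ∀ x ∈ O r, ∀ i, 0 < x i ∧ x i < 1
  /-- … and pairwise disjoint. -/
  disjoint : ∀ r r', r ≠ r' → Disjoint (O r) (O r')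
  /-- Their projections to each coordinate axis are pairwise disjoint. -/
  disjoint_proj : ∀ i : Fin m, ∀ r r', r ≠ r' →
    Disjoint ((fun x : Space m => x i) '' O r) ((fun x : Space m => x i) '' O r')
  /-- No-eclipse condition in the cube. -/
  no_eclipse : ∀ r s t, r ≠ s → s ≠ t → r ≠ t →
    Disjoint (O r) (convexHull ℝ (O s ∪ O t))

/-- Labels `(k, r)` of the lifted obstacles. -/
abbrev Label (m N : ℕ) : Type := (Fin m → ℤ) × Fin N

variable {m N : ℕ}

/-- The lifted obstacle `O_(k, r) = O_r + k`. -/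
def lifted (O : Fin N → Set (Space m)) (a : Label m N) : Set (Space m) :=
  (fun x => x + latticeVec a.1) '' O a.2

/-- The billiard domain `Ω`, the closure of the complement of the union of all lifted obstacles. -/
def domain (O : Fin N → Set (Space m)) : Set (Space m) :=
  closure (⋃ a : Label m N, lifted O a)ᶜ

/-- The obstacle labelled `a` is between those labelled `b` and `c`: it is a third obstacle, and it
has a common point with the convex hull of the union of these two. -/
def Between (O : Fin N → Set (Space m)) (a b c : Label m N) : Prop :=
  a ≠ b ∧ a ≠ c ∧ (lifted O a ∩ convexHull ℝ (lifted O b ∪ lifted O c)).Nonempty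

/-- The sequence `(s 0, …, s p)` (the sequence `(s n)_{n ≥ 0}` if `p = ⊤`) is admissible. -/
structure IsAdmissible (O : Fin N → Set (Space m)) (p : ℕ∞) (s : ℕ → Label m N) : Prop where
  start : (s 0).1 = 0
  ne : ∀ n : ℕ, (n : ℕ∞) < p → s (n + 1) ≠ s n
  unobstructed : ∀ n : ℕ, (n : ℕ∞) < p → ∀ a, ¬ Between O a (s n) (s (n + 1))
  not_between : ∀ n : ℕ, ((n + 1 : ℕ) : ℕ∞) < p → ¬ Between O (s (n + 1)) (s n) (s (n + 2))

/-- `ν` is an outward unit normal of the convex set `S` at `x`. If `S` is a convex body with `C²`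
boundary and `x` is a boundary point of it, there is exactly one. -/
def IsOutwardNormal (S : Set (Space m)) (x ν : Space m) : Prop :=
  ‖ν‖ = 1 ∧ ∀ y ∈ S, inner ℝ ν (y - x) ≤ 0

/-- The unit vector pointing from `x` to `y` (for `x ≠ y`). -/
def direction (x y : Space m) : Space m := ‖y - x‖⁻¹ • (y - x)

/-- Elastic reflection (angle of incidence equal to angle of reflection) from `S` at the point `x`,
with incoming velocity `v` and outgoing velocity `w`. -/
def Reflects (S : Set (Space m)) (x v w : Space m) : Prop :=
  ∃ ν, IsOutwardNormal S x ν ∧ w = v - (2 * inner ℝ v ν) • ν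

/-- `x 0, …, x p` (all `x n` if `p = ⊤`) are the initial point and the consecutive reflection points
of a (lifted) billiard trajectory piece of type `(s 0, …, s p)`. -/
structure IsTrajectoryOfType (O : Fin N → Set (Space m)) (p : ℕ∞) (s : ℕ → Label m N)
    (x : ℕ → Space m) : Prop where
  mem_frontier : ∀ n : ℕ, (n : ℕ∞) ≤ p → x n ∈ frontier (lifted O (s n))
  segment_subset : ∀ n : ℕ, (n : ℕ∞) < p → segment ℝ (x n) (x (n + 1)) ⊆ domain O
  reflects : ∀ n : ℕ, ((n + 1 : ℕ) : ℕ∞) < p →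
    Reflects (lifted O (s (n + 1))) (x (n + 1))
      (direction (x n) (x (n + 1))) (direction (x (n + 1)) (x (n + 2)))

/-- The length of the piece of the trajectory from `x 0` to `x n`. -/
def pathLength (x : ℕ → Space m) (n : ℕ) : ℝ :=
  ∑ j ∈ Finset.range n, dist (x j) (x (j + 1))

/-- The displacement divided by the length, for the piece of the trajectory from `x 0` to `x n`. -/
def meanDisplacement (x : ℕ → Space m) (n : ℕ) : Space m :=
  (pathLength x n)⁻¹ • (x n - x 0)

/-- The admissible rotation set `AR`: all limit points of sequences `d(T_n) / |T_n|`, where the `T_n`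
are trajectory pieces of (finite) admissible type whose lengths tend to infinity. -/
def admissibleRotationSet (O : Fin N → Set (Space m)) : Set (Space m) :=
  {v | ∃ (p : ℕ → ℕ) (s : ℕ → ℕ → Label m N) (x : ℕ → ℕ → Space m),
    (∀ n, IsAdmissible O (p n) (s n) ∧ IsTrajectoryOfType O (p n) (s n) (x n)) ∧
    Tendsto (fun n => pathLength (x n) (p n)) atTop atTop ∧
    MapClusterPt v atTop (fun n => meanDisplacement (x n) (p n))}

/-- The projection of the trajectory to the torus is a periodic orbit. -/
def IsPeriodicOnTorus (x : ℕ → Space m) : Prop :=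
  ∃ q : ℕ, 0 < q ∧ ∃ k : Fin m → ℤ, ∀ n, x (n + q) = x n + latticeVec k

/-- `v` is the rotation vector of the (infinite) trajectory. -/
def IsRotationVector (x : ℕ → Space m) (v : Space m) : Prop :=
  Tendsto (meanDisplacement x) atTop (𝓝 v)

/-- The set of the rotation vectors of the periodic trajectories of admissible type. -/
def periodicRotationVectors (O : Fin N → Set (Space m)) : Set (Space m) :=
  {v | ∃ (s : ℕ → Label m N) (x : ℕ → Space m), IsAdmissible O ⊤ s ∧
    IsTrajectoryOfType O ⊤ s x ∧ IsPeriodicOnTorus x ∧ IsRotationVector x v}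

end TorusBilliard

end

open Set Filter Topology

noncomputable section

namespace TorusBilliard

variable {m N : ℕ}

/-! ### Lifted obstacles -/

/-! One inclusion is immediate: the initial pieces of a periodic trajectory have length tending to
infinity. For density, every piece `T` of admissible type is replaced by a periodic trajectory whose
length and displacement over one period differ from those of `T` by at most a constant depending
only on the obstacles (`exists_periodic_closing`). The two quotients then differ by O(1/|T|).

The closing of the type is combinatorial. Up to the normalisation of the first label, admissibility
is a condition on three consecutive labels (`Passes`). Unit translates of an obstacle are visible
from it (`visible_shift_single`), right-angled turns between them are allowed because obstacles are
small (`passes_turn`), and any arriving edge can be continued to some unit translate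
(`exists_passes_unit`). Hence one can always switch to a standard edge from `a` to `a + e_i` at
bounded cost. The piece read backwards shows that its last type is connected to its first, and there
are only finitely many pairs of types, so the closing has bounded length (`exists_closing_route`).

A periodic type is realised by a shortest closed path, which exists by compactness and obeys the
reflection law because no obstacle of the sequence is between its neighbours
(`isTrajectoryOfType_of_isMinOn`). Conversely, convexity of length makes any trajectory piece
shortest via its obstacles up to an additive constant (`pathLength_le_of_trajectory`). The two
minimality statements together compare the lengths. -/

/-- The label of the obstacle labelled `a`, translated by `k`. -/
def shift (k : Fin m → ℤ) (a : Label m N) : Label m N := (a.1 + k, a.2)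

@[simp] lemma shift_snd (k : Fin m → ℤ) (a : Label m N) : (shift k a).2 = a.2 := rfl

@[simp] lemma shift_fst (k : Fin m → ℤ) (a : Label m N) : (shift k a).1 = a.1 + k := rfl

@[simp] lemma shift_zero (a : Label m N) : shift 0 a = a := by
  ext <;> simp [shift]

lemma shift_shift (k l : Fin m → ℤ) (a : Label m N) : shift k (shift l a) = shift (l + k) a := by
  ext <;> simp [shift, add_assoc]

lemma shift_injective (k : Fin m → ℤ) : Function.Injective (shift (N := N) k) := by
  rintro ⟨a, r⟩ ⟨b, r'⟩ h
  simpa [shift] using h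

lemma shift_eq_self_iff {k : Fin m → ℤ} {a : Label m N} : shift k a = a ↔ k = 0 := by
  rcases a with ⟨a, r⟩
  simp [shift]

@[simp] lemma latticeVec_apply (k : Fin m → ℤ) (i : Fin m) : latticeVec k i = k i := rfl

@[simp] lemma latticeVec_zero : latticeVec (0 : Fin m → ℤ) = 0 := by
  ext i; simp

@[simp] lemma latticeVec_add (k l : Fin m → ℤ) :
    latticeVec (k + l) = latticeVec k + latticeVec l := by
  ext i; simp

@[simp] lemma latticeVec_neg (k : Fin m → ℤ) : latticeVec (-k) = -latticeVec k := by
  ext i; simp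

lemma norm_latticeVec_single (i : Fin m) (σ : ℤ) : ‖latticeVec (Pi.single i σ)‖ = |(σ : ℝ)| := by
  have : latticeVec (Pi.single i σ) = EuclideanSpace.single i (σ : ℝ) := by
    ext j
    rcases eq_or_ne j i with rfl | h
    · simp
    · simp [h]
  rw [this]
  simp

variable {O : Fin N → Set (Space m)}

lemma mem_lifted {a : Label m N} {z : Space m} :
    z ∈ lifted O a ↔ z - latticeVec a.1 ∈ O a.2 := by
  simp only [lifted, mem_image]
  constructor
  · rintro ⟨x, hx, rfl⟩
    simpa using hx
  · intro h
    exact ⟨_, h, by simp⟩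

lemma mem_lifted_shift {k : Fin m → ℤ} {a : Label m N} {z : Space m} :
    z ∈ lifted O (shift k a) ↔ z - latticeVec k ∈ lifted O a := by
  rw [mem_lifted, mem_lifted]
  simp [sub_sub, add_comm]

lemma add_mem_lifted_shift {k : Fin m → ℤ} {a : Label m N} {z : Space m} :
    z + latticeVec k ∈ lifted O (shift k a) ↔ z ∈ lifted O a := by
  rw [mem_lifted_shift, add_sub_cancel_right]

lemma lifted_shift (k : Fin m → ℤ) (a : Label m N) :
    lifted O (shift k a) = (fun z => z + latticeVec k) '' lifted O a := by
  ext z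
  rw [mem_lifted_shift]
  constructor
  · intro h
    exact ⟨_, h, by simp⟩
  · rintro ⟨y, hy, rfl⟩
    simpa using hy

namespace IsObstacleFamily

lemma isCompact_lifted (hO : IsObstacleFamily O) (a : Label m N) : IsCompact (lifted O a) :=
  (hO.isCompact a.2).image (by fun_prop)

lemma convex_lifted (hO : IsObstacleFamily O) (a : Label m N) : Convex ℝ (lifted O a) := by
  have h := (hO.strictConvex a.2).convex.translate (latticeVec a.1)
  have he : lifted O a = (fun x => latticeVec a.1 + x) '' O a.2 :=
    image_congr fun x _ => add_comm _ _
  rwa [he]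

lemma nonempty (hO : IsObstacleFamily O) (r : Fin N) : (O r).Nonempty :=
  (hO.interior_nonempty r).mono interior_subset

lemma dist_lt (hO : IsObstacleFamily O) {a : Label m N} {y z : Space m}
    (hy : y ∈ lifted O a) (hz : z ∈ lifted O a) : dist y z < Real.sqrt 2 / 4 := by
  rw [mem_lifted] at hy hz
  have h := Metric.dist_le_diam_of_mem (hO.isCompact a.2).isBounded hy hz
  rw [dist_sub_right] at h
  exact h.trans_lt (hO.diam_lt _)

lemma dist_le_one (hO : IsObstacleFamily O) {a : Label m N} {y z : Space m}
    (hy : y ∈ lifted O a) (hz : z ∈ lifted O a) : dist y z ≤ 1 := by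
  have h2 : Real.sqrt 2 ≤ 4 := by
    rw [Real.sqrt_le_left (by norm_num)]
    norm_num
  linarith [hO.dist_lt hy hz]

lemma mem_cube_lifted (hO : IsObstacleFamily O) {a : Label m N} {z : Space m}
    (hz : z ∈ lifted O a) (i : Fin m) : (a.1 i : ℝ) < z i ∧ z i < a.1 i + 1 := by
  rw [mem_lifted] at hz
  have h := hO.mem_cube _ _ hz i
  simp only [PiLp.sub_apply, latticeVec_apply] at h
  constructor <;> linarith

/-- The obstacles lie in open unit cubes, so one coordinate determines the integer part in that
direction; disjointness of the projections then determines the type. -/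
lemma eq_of_apply_eq (hO : IsObstacleFamily O) {a b : Label m N} {y z : Space m}
    (hy : y ∈ lifted O a) (hz : z ∈ lifted O b) {i : Fin m} (h : y i = z i) :
    a.1 i = b.1 i ∧ a.2 = b.2 := by
  have h1 := hO.mem_cube_lifted hy i
  have h2 := hO.mem_cube_lifted hz i
  have h3 : a.1 i = b.1 i := by
    rw [h] at h1
    have h4 : (a.1 i : ℝ) < b.1 i + 1 := by linarith
    have h5 : (b.1 i : ℝ) < a.1 i + 1 := by linarith
    have h4' : a.1 i < b.1 i + 1 := by exact_mod_cast h4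
    have h5' : b.1 i < a.1 i + 1 := by exact_mod_cast h5
    omega
  refine ⟨h3, ?_⟩
  by_contra hne
  rw [mem_lifted] at hy hz
  refine (hO.disjoint_proj i _ _ hne).le_bot ⟨⟨_, hy, rfl⟩, ⟨_, hz, ?_⟩⟩
  simp [h, h3]

lemma disjoint_lifted (hO : IsObstacleFamily O) (hm : 2 ≤ m) {a b : Label m N} (hab : a ≠ b) :
    Disjoint (lifted O a) (lifted O b) := by
  rw [Set.disjoint_left]
  intro z hza hzb
  apply hab
  ext i
  · exact (hO.eq_of_apply_eq hza hzb (i := i) rfl).1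
  · exact congrArg _ (hO.eq_of_apply_eq hza hzb (i := ⟨0, by omega⟩) rfl).2

end IsObstacleFamily

/-! ### Visibility -/

lemma Between.symm {a b c : Label m N} (h : Between O a b c) : Between O a c b := by
  obtain ⟨h1, h2, h3⟩ := h
  exact ⟨h2, h1, by rwa [union_comm]⟩

lemma not_between_self (hm : 2 ≤ m) (hO : IsObstacleFamily O) (a b : Label m N) :
    ¬ Between O a b b := by
  rintro ⟨h1, -, z, hz, hz'⟩
  rw [union_self, (hO.convex_lifted b).convexHull_eq] at hz'
  exact (hO.disjoint_lifted hm h1).le_bot ⟨hz, hz'⟩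

open scoped Pointwise in
lemma between_shift (k : Fin m → ℤ) {a b c : Label m N} :
    Between O (shift k a) (shift k b) (shift k c) ↔ Between O a b c := by
  have h : ∀ S : Set (Space m), (fun z => z + latticeVec k) '' S = ({latticeVec k} : Set (Space m)) + S := by
    intro S
    rw [singleton_add]
    simp [add_comm]
  unfold Between
  rw [(shift_injective k).ne_iff, (shift_injective k).ne_iff]
  refine and_congr_right fun _ => and_congr_right fun _ => ?_
  rw [lifted_shift, lifted_shift, lifted_shift, ← image_union, h (_ ∪ _), convexHull_add,
    convexHull_singleton, ← h, ← image_inter (add_left_injective _), image_nonempty]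

/-- Two distinct obstacles with no obstacle between them. -/
def Visible (O : Fin N → Set (Space m)) (a b : Label m N) : Prop :=
  b ≠ a ∧ ∀ c, ¬ Between O c a b

lemma Visible.symm {a b : Label m N} (h : Visible O a b) : Visible O b a :=
  ⟨h.1.symm, fun c hc => h.2 c hc.symm⟩

lemma Visible.shift {a b : Label m N} (h : Visible O a b) (k : Fin m → ℤ) :
    Visible O (shift k a) (shift k b) := by
  refine ⟨(shift_injective k).ne h.1, fun c hc => h.2 (TorusBilliard.shift (-k) c) ?_⟩
  rw [← between_shift k, shift_shift]
  simpa using hc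

/-- An admissible sequence of three labels, up to the position of the first one. -/
structure Passes (O : Fin N → Set (Space m)) (a b c : Label m N) : Prop where
  fst : Visible O a b
  snd : Visible O b c
  not_between : ¬ Between O b a c

lemma Passes.shift {a b c : Label m N} (h : Passes O a b c) (k : Fin m → ℤ) :
    Passes O (shift k a) (shift k b) (shift k c) :=
  ⟨h.fst.shift k, h.snd.shift k, fun h' => h.not_between ((between_shift k).1 h')⟩

lemma Passes.reverse {a b c : Label m N} (h : Passes O a b c) : Passes O c b a :=
  ⟨h.snd.symm, h.fst.symm, fun h' => h.not_between h'.symm⟩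

lemma Visible.passes_back (hm : 2 ≤ m) (hO : IsObstacleFamily O) {a b : Label m N}
    (h : Visible O a b) : Passes O a b a :=
  ⟨h, h.symm, not_between_self hm hO _ _⟩

/-- A coordinate is a linear functional. -/
lemma isLinearMap_apply (i : Fin m) : IsLinearMap ℝ (fun z : Space m => z i) :=
  ⟨fun _ _ => rfl, fun _ _ => rfl⟩

lemma exists_ne_fin (hm : 2 ≤ m) (i : Fin m) : ∃ j : Fin m, j ≠ i := by
  have : Nontrivial (Fin m) := Fin.nontrivial_iff_two_le.2 hm
  exact exists_ne i

/-- In every direction `j ≠ i` the hull projects into the projection of `a`, which forces the type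
and the `j`-th integer coordinate of an obstacle meeting it. In direction `i` the hull spans less
than two cells, so only the two given obstacles remain. -/
lemma visible_shift_single_one (hm : 2 ≤ m) (hO : IsObstacleFamily O) (a : Label m N)
    (i : Fin m) : Visible O a (shift (Pi.single i 1) a) := by
  refine ⟨by rw [ne_eq, shift_eq_self_iff]; simp, ?_⟩
  rintro b ⟨hba, hbs, z, hzb, hz⟩
  have hj : ∀ j ≠ i, b.1 j = a.1 j ∧ b.2 = a.2 := by
    intro j hj
    have hsub : convexHull ℝ (lifted O a ∪ lifted O (shift (Pi.single i 1) a)) ⊆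
        (fun z : Space m => z j) ⁻¹' ((fun z : Space m => z j) '' lifted O a) := by
      refine convexHull_min ?_ (((hO.convex_lifted a).is_linear_image
        (isLinearMap_apply j)).is_linear_preimage (isLinearMap_apply j))
      rintro y (hy | hy)
      · exact ⟨y, hy, rfl⟩
      · rw [mem_lifted_shift] at hy
        exact ⟨_, hy, by simp [hj]⟩
    obtain ⟨y, hy, hyz⟩ := hsub hz
    exact hO.eq_of_apply_eq hzb hy hyz.symm
  obtain ⟨j, hji⟩ := exists_ne_fin hm i
  have hr := (hj j hji).2
  have hi : (a.1 i : ℝ) < z i ∧ z i < a.1 i + 2 := by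
    have hsub : convexHull ℝ (lifted O a ∪ lifted O (shift (Pi.single i 1) a)) ⊆
        {z : Space m | (a.1 i : ℝ) < z i} ∩ {z : Space m | z i < (a.1 i : ℝ) + 2} := by
      refine convexHull_min ?_ ((convex_halfSpace_gt (isLinearMap_apply i) _).inter
        (convex_halfSpace_lt (isLinearMap_apply i) _))
      rintro y (hy | hy)
      · have := hO.mem_cube_lifted hy i
        exact ⟨this.1, by simp only [mem_ofPred_eq]; linarith⟩
      · have := hO.mem_cube_lifted hy i
        simp only [shift_fst, Pi.add_apply, Pi.single_eq_same, Int.cast_add, Int.cast_one] at this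
        constructor <;> simp only [mem_ofPred_eq] <;> linarith
    exact hsub hz
  have hb := hO.mem_cube_lifted hzb i
  have h1 : (a.1 i : ℝ) < b.1 i + 1 := by linarith
  have h2 : (b.1 i : ℝ) < a.1 i + 2 := by linarith
  have h1' : a.1 i < b.1 i + 1 := by exact_mod_cast h1
  have h2' : b.1 i < a.1 i + 2 := by exact_mod_cast h2
  rcases (by omega : b.1 i = a.1 i ∨ b.1 i = a.1 i + 1) with h | h
  · apply hba
    refine Prod.ext (funext fun l => ?_) hr
    rcases eq_or_ne l i with rfl | hl
    · exact h
    · exact (hj l hl).1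
  · apply hbs
    refine Prod.ext (funext fun l => ?_) hr
    rcases eq_or_ne l i with rfl | hl
    · simp [h]
    · simp [hl, (hj l hl).1]

lemma visible_shift_single (hm : 2 ≤ m) (hO : IsObstacleFamily O) (a : Label m N)
    (i : Fin m) {σ : ℤ} (hσ : σ = 1 ∨ σ = -1) : Visible O a (shift (Pi.single i σ) a) := by
  rcases hσ with rfl | rfl
  · exact visible_shift_single_one hm hO a i
  · have h := (visible_shift_single_one hm hO (shift (Pi.single i (-1)) a) i).symm
    rw [shift_shift, ← Pi.single_add] at h
    simpa using h

/-- A point of the hull is a point of `a` displaced by `s • u + t • v`, where `u`, `v` are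
perpendicular unit vectors and `s + t = 1`. This displacement has norm at least `√2 / 2`, more than
the diameter of `a`. -/
lemma passes_turn (hm : 2 ≤ m) (hO : IsObstacleFamily O) (a : Label m N) {i j : Fin m}
    (hij : i ≠ j) {σ τ : ℤ} (hσ : σ = 1 ∨ σ = -1) (hτ : τ = 1 ∨ τ = -1) :
    Passes O (shift (Pi.single i σ) a) a (shift (Pi.single j τ) a) := by
  refine ⟨(visible_shift_single hm hO a i hσ).symm, visible_shift_single hm hO a j hτ, ?_⟩
  rintro ⟨-, -, z, hza, hz⟩
  rw [convexHull_union, (hO.convex_lifted _).convexHull_eq, (hO.convex_lifted _).convexHull_eq,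
    mem_convexJoin] at hz
  · obtain ⟨x, hx, y, hy, hz⟩ := hz
    obtain ⟨s, t, hs, ht, hst, rfl⟩ := hz
    rw [mem_lifted_shift] at hx hy
    have hw := hO.convex_lifted a hx hy hs ht hst
    have hd := hO.dist_lt hza hw
    set u := latticeVec (Pi.single i σ) with hu
    set v := latticeVec (Pi.single j τ) with hv
    have he : s • x + t • y - (s • (x - u) + t • (y - v)) = s • u + t • v := by
      simp only [smul_sub]; abel
    rw [dist_eq_norm, he] at hd
    have hui : (u : Space m) i = σ := by simp [hu]
    have huj : (u : Space m) j = 0 := by simp [hu, hij.symm]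
    have hvi : (v : Space m) i = 0 := by simp [hv, hij]
    have hvj : (v : Space m) j = τ := by simp [hv]
    have h1 : s ^ 2 + t ^ 2 ≤ ‖s • u + t • v‖ ^ 2 := by
      rw [EuclideanSpace.norm_sq_eq]
      have h2 : ∑ l ∈ ({i, j} : Finset (Fin m)), ‖(s • u + t • v) l‖ ^ 2 = s ^ 2 + t ^ 2 := by
        rw [Finset.sum_pair hij]
        simp only [PiLp.add_apply, PiLp.smul_apply, hui, huj, hvi, hvj, smul_eq_mul]
        rcases hσ with rfl | rfl <;> rcases hτ with rfl | rfl <;> simp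
      rw [← h2]
      exact Finset.sum_le_sum_of_subset_of_nonneg (Finset.subset_univ _)
        (fun _ _ _ => by positivity)
    have h3 : ‖s • u + t • v‖ ^ 2 < (Real.sqrt 2 / 4) ^ 2 := by gcongr
    rw [div_pow, Real.sq_sqrt (by norm_num)] at h3
    nlinarith [sq_nonneg (s - t), show (s + t) ^ 2 = 1 by rw [hst]; norm_num]
  · obtain ⟨x, hx⟩ := hO.nonempty (shift (Pi.single i σ) a).2
    exact ⟨_, x, hx, rfl⟩
  · obtain ⟨x, hx⟩ := hO.nonempty (shift (Pi.single j τ) a).2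
    exact ⟨_, x, hx, rfl⟩

open scoped Pointwise in
/-- The projections of two distinct obstacles to some coordinate axis are separated. -/
lemma exists_coordinate_lt (hm : 2 ≤ m) (hO : IsObstacleFamily O) {a b : Label m N}
    (hab : a ≠ b) : ∃ i, (∀ x ∈ lifted O a, ∀ y ∈ lifted O b, x i < y i) ∨
      (∀ x ∈ lifted O a, ∀ y ∈ lifted O b, y i < x i) := by
  have hi : ∃ i : Fin m, ¬ (a.1 i = b.1 i ∧ a.2 = b.2) := by
    by_contra! h
    exact hab (Prod.ext (funext fun i => (h i).1) (h ⟨0, by omega⟩).2)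
  obtain ⟨i, hi⟩ := hi
  refine ⟨i, ?_⟩
  by_contra! h
  obtain ⟨⟨x, hx, y, hy, hxy⟩, ⟨x', hx', y', hy', hxy'⟩⟩ := h
  let f : Space m → ℝ := fun z => z i
  have hA : Convex ℝ (f '' lifted O a) := (hO.convex_lifted a).is_linear_image (isLinearMap_apply i)
  have hB : Convex ℝ (f '' lifted O b) := (hO.convex_lifted b).is_linear_image (isLinearMap_apply i)
  -- The differences form an interval containing values `≤ 0` and `≥ 0`, hence contain 0: the
  -- projections would meet.
  have h0 : (0 : ℝ) ∈ f '' lifted O a - f '' lifted O b :=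
    (hA.sub hB).ordConnected.out (sub_mem_sub ⟨x', hx', rfl⟩ ⟨y', hy', rfl⟩)
      (sub_mem_sub ⟨x, hx, rfl⟩ ⟨y, hy, rfl⟩) ⟨sub_nonpos.2 hxy', sub_nonneg.2 hxy⟩
  obtain ⟨_, ⟨z, hz, rfl⟩, _, ⟨w, hw, rfl⟩, h0⟩ := h0
  exact hi (hO.eq_of_apply_eq hz hw (sub_eq_zero.1 h0))

/-- Along a separating axis, step to the translate on the same side of `a` as `b`. A coordinate
half-space then contains both neighbours and misses any given point of `a`. -/
lemma exists_passes_unit (hm : 2 ≤ m) (hO : IsObstacleFamily O) {a b : Label m N}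
    (h : Visible O b a) : ∃ (i : Fin m) (σ : ℤ), (σ = 1 ∨ σ = -1) ∧
      Passes O b a (shift (Pi.single i σ) a) := by
  obtain ⟨i, hi | hi⟩ := exists_coordinate_lt hm hO h.1
  · refine ⟨i, 1, .inl rfl, h, visible_shift_single hm hO a i (.inl rfl), ?_⟩
    rintro ⟨-, -, z, hza, hz⟩
    have hsub : convexHull ℝ (lifted O b ∪ lifted O (shift (Pi.single i 1) a)) ⊆
        {y : Space m | z i < y i} := by
      refine convexHull_min ?_ (convex_halfSpace_gt (isLinearMap_apply i) _)
      rintro y (hy | hy)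
      · exact hi z hza y hy
      · have h1 := hO.mem_cube_lifted hy i
        have h2 := hO.mem_cube_lifted hza i
        simp only [shift_fst, Pi.add_apply, Pi.single_eq_same, Int.cast_add, Int.cast_one] at h1
        simp only [mem_ofPred_eq]
        linarith
    exact lt_irrefl (z i) (hsub hz)
  · refine ⟨i, -1, .inr rfl, h, visible_shift_single hm hO a i (.inr rfl), ?_⟩
    rintro ⟨-, -, z, hza, hz⟩
    have hsub : convexHull ℝ (lifted O b ∪ lifted O (shift (Pi.single i (-1)) a)) ⊆
        {y : Space m | y i < z i} := by
      refine convexHull_min ?_ (convex_halfSpace_lt (isLinearMap_apply i) _)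
      rintro y (hy | hy)
      · exact hi z hza y hy
      · have h1 := hO.mem_cube_lifted hy i
        have h2 := hO.mem_cube_lifted hza i
        simp only [shift_fst, Pi.add_apply, Pi.single_eq_same, Int.cast_add, Int.cast_neg,
          Int.cast_one] at h1
        simp only [mem_ofPred_eq]
        linarith
    exact lt_irrefl (z i) (hsub hz)

/-! ### Connecting admissible sequences -/

/-- The representative of the obstacle labelled `a`, given one for each type. -/
def rep (c : Fin N → Space m) (a : Label m N) : Space m := c a.2 + latticeVec a.1

lemma rep_shift (c : Fin N → Space m) (k : Fin m → ℤ) (a : Label m N) :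
    rep c (shift k a) = rep c a + latticeVec k := by
  simp [rep, add_assoc]

lemma dist_rep_shift (c : Fin N → Space m) (k : Fin m → ℤ) (a b : Label m N) :
    dist (rep c (shift k a)) (rep c (shift k b)) = dist (rep c a) (rep c b) := by
  rw [rep_shift, rep_shift, dist_add_right]

lemma dist_rep_unit (c : Fin N → Space m) (i : Fin m) {σ : ℤ} (hσ : σ = 1 ∨ σ = -1)
    (a : Label m N) : dist (rep c a) (rep c (shift (Pi.single i σ) a)) = 1 := by
  rw [rep_shift, dist_self_add_right, norm_latticeVec_single]
  rcases hσ with rfl | rfl <;> simp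

/-- `Route O c a b x y ℓ`: an admissible sequence starts with `a, b` and ends with `x, y`; the length
of its part after `a`, measured between the representatives, is `ℓ`. -/
inductive Route (O : Fin N → Set (Space m)) (c : Fin N → Space m) (a b : Label m N) :
    Label m N → Label m N → ℝ → Prop
  | single {z : Label m N} (h : Passes O a b z) : Route O c a b b z (dist (rep c b) (rep c z))
  | step {x y z : Label m N} {ℓ : ℝ} (hr : Route O c a b x y ℓ) (h : Passes O x y z) :
      Route O c a b y z (ℓ + dist (rep c y) (rep c z))

variable {c : Fin N → Space m}

/-- Routes are glued along a whole edge, so no new triple arises at the junction; the shared edge is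
counted only in the first length. -/
lemma Route.trans {a b x y z w : Label m N} {ℓ ℓ' : ℝ} (h : Route O c a b x y ℓ)
    (h' : Route O c x y z w ℓ') : Route O c a b z w (ℓ + ℓ') := by
  induction h' with
  | single hp => exact h.step hp
  | step _ hp ih => rw [← add_assoc]; exact ih.step hp

lemma Route.shift {a b x y : Label m N} {ℓ : ℝ} (h : Route O c a b x y ℓ) (k : Fin m → ℤ) :
    Route O c (shift k a) (shift k b) (shift k x) (shift k y) ℓ := by
  induction h with
  | single hp => rw [← dist_rep_shift c k]; exact .single (hp.shift k)
  | @step x y z ℓ _ hp ih => rw [← dist_rep_shift c k y]; exact ih.step (hp.shift k)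

lemma Route.exists_seq {a b x y : Label m N} {ℓ : ℝ} (h : Route O c a b x y ℓ) :
    ∃ (n : ℕ) (w : ℕ → Label m N), w 0 = a ∧ w 1 = b ∧ w (n + 1) = x ∧ w (n + 2) = y ∧
      (∀ j ≤ n, Passes O (w j) (w (j + 1)) (w (j + 2))) ∧
      ∑ j ∈ Finset.range (n + 1), dist (rep c (w (j + 1))) (rep c (w (j + 2))) = ℓ := by
  induction h with
  | @single z hp =>
    refine ⟨0, fun j => if j = 0 then a else if j = 1 then b else z, ?_⟩
    simpa using hp
  | @step x y z ℓ _ hp ih =>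
    obtain ⟨n, w, h0, h1, h2, h3, h4, h5⟩ := ih
    have hlt : ∀ j ≤ n + 2, (fun j => if j ≤ n + 2 then w j else z) j = w j :=
      fun j hj => if_pos hj
    have hlast : (fun j => if j ≤ n + 2 then w j else z) (n + 3) = z := if_neg (by omega)
    generalize (fun j => if j ≤ n + 2 then w j else z) = w' at hlt hlast
    refine ⟨n + 1, w', ?_, ?_, ?_, hlast, ?_, ?_⟩
    · rw [hlt _ (by omega), h0]
    · rw [hlt _ (by omega), h1]
    · rw [hlt _ (by omega), h3]
    · intro j hj
      rcases hj.lt_or_eq with hj | rfl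
      · rw [hlt _ (by omega), hlt _ (by omega), hlt _ (by omega)]
        exact h4 j (by omega)
      · rw [hlt _ (by omega), hlt _ (by omega), hlast, h2, h3]
        exact hp
    · rw [Finset.sum_range_succ, hlast, hlt (n + 1 + 1) (by omega), h3, ← h5]
      congr 1
      refine Finset.sum_congr rfl fun j hj => ?_
      rw [Finset.mem_range] at hj
      rw [hlt _ (by omega), hlt _ (by omega)]

/-- Return along the edge just taken, then turn: two unit steps. -/
lemma route_unit_of_ne (hm : 2 ≤ m) (hO : IsObstacleFamily O) (a : Label m N) {i j : Fin m}
    (hij : i ≠ j) {σ τ : ℤ} (hσ : σ = 1 ∨ σ = -1) (hτ : τ = 1 ∨ τ = -1) :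
    Route O c a (shift (Pi.single i σ) a) a (shift (Pi.single j τ) a) 2 := by
  have h1 : Route O c a (shift (Pi.single i σ) a) (shift (Pi.single i σ) a) a _ :=
    .single ((visible_shift_single hm hO a i hσ).passes_back hm hO)
  have h2 := h1.step (passes_turn hm hO a hij hσ hτ)
  rw [dist_comm, dist_rep_unit c i hσ, dist_rep_unit c j hτ] at h2
  norm_num at h2
  exact h2

lemma route_unit (hm : 2 ≤ m) (hO : IsObstacleFamily O) (a : Label m N) (i j : Fin m)
    {σ τ : ℤ} (hσ : σ = 1 ∨ σ = -1) (hτ : τ = 1 ∨ τ = -1) :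
    ∃ ℓ ≤ 4, Route O c a (shift (Pi.single i σ) a) a (shift (Pi.single j τ) a) ℓ := by
  by_cases hij : i = j
  · subst hij
    -- Turns need distinct axes, so an exit along the same axis makes a detour along a second one.
    obtain ⟨l, hl⟩ := exists_ne_fin hm i
    refine ⟨2 + 2, by norm_num, ?_⟩
    exact (route_unit_of_ne hm hO a hl.symm hσ (.inl rfl)).trans
      (route_unit_of_ne hm hO a hl (.inl rfl) hτ)
  · exact ⟨2, by norm_num, route_unit_of_ne hm hO a hij hσ hτ⟩

/-! ### Bounded connections through standard edges -/

/-- A step from an obstacle to its translate by `e_i`. -/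
def hub (i : Fin m) (a : Label m N) : Label m N := shift (Pi.single i 1) a

lemma shift_hub (i : Fin m) (k : Fin m → ℤ) (a : Label m N) :
    shift k (hub i a) = hub i (shift k a) := by
  simp [hub, shift_shift, add_comm]

/-- The bound is 1 for the first unit step plus 4 for the change of direction. The edge from `b` to
`a` is not counted, so the bound is uniform although the distance of visible obstacles is not
controlled. -/
lemma Visible.route_hub (hm : 2 ≤ m) (hO : IsObstacleFamily O) (i : Fin m) {a b : Label m N}
    (h : Visible O b a) : ∃ ℓ ≤ 5, Route O c b a a (hub i a) ℓ := by
  obtain ⟨j, σ, hσ, hp⟩ := exists_passes_unit hm hO h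
  obtain ⟨ℓ, hℓ, hr⟩ := route_unit (c := c) hm hO a j i hσ (.inl rfl)
  have h1 := (Route.single hp (c := c)).trans hr
  rw [dist_rep_unit c j hσ] at h1
  exact ⟨_, by linarith, h1⟩

/-- Admissible triples may be reversed, so a unit step compatible with arriving from `b` also
precedes departure to `b`. The edge to `b` is again left out of the length. -/
lemma Visible.hub_route (hm : 2 ≤ m) (hO : IsObstacleFamily O) (i : Fin m) {a b : Label m N}
    (h : Visible O a b) : ∃ ℓ ≤ 5, ∃ d, Route O c a (hub i a) d a ℓ ∧ Passes O d a b := by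
  obtain ⟨j, σ, hσ, hp⟩ := exists_passes_unit hm hO h.symm
  obtain ⟨ℓ, hℓ, hr⟩ := route_unit (c := c) hm hO a i j (.inl rfl) hσ
  have h1 := hr.step (hp.snd.passes_back hm hO)
  rw [dist_comm, dist_rep_unit c j hσ] at h1
  exact ⟨_, by linarith, _, h1, hp.reverse⟩

/-- Obstacles of type `r` are connected to some obstacle of type `r'`. -/
def HubRoute (O : Fin N → Set (Space m)) (c : Fin N → Space m) (i : Fin m) (r r' : Fin N)
    (ℓ : ℝ) : Prop :=
  ∃ k : Fin m → ℤ, Route O c (0, r) (hub i (0, r)) (k, r') (hub i (k, r')) ℓ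

lemma HubRoute.route {i : Fin m} {a : Label m N} {r' : Fin N} {ℓ : ℝ}
    (h : HubRoute O c i a.2 r' ℓ) :
    ∃ k : Fin m → ℤ, Route O c a (hub i a) (k, r') (hub i (k, r')) ℓ := by
  obtain ⟨k, hk⟩ := h
  have h1 := hk.shift a.1
  rw [shift_hub, shift_hub] at h1
  refine ⟨k + a.1, ?_⟩
  convert h1 using 2 <;> simp [shift]

lemma Route.hubRoute {i : Fin m} {a b : Label m N} {ℓ : ℝ}
    (h : Route O c a (hub i a) b (hub i b) ℓ) : HubRoute O c i a.2 b.2 ℓ := by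
  have h1 := h.shift (-a.1)
  rw [shift_hub, shift_hub] at h1
  refine ⟨b.1 + -a.1, ?_⟩
  convert h1 using 2 <;> simp [TorusBilliard.shift]

lemma HubRoute.trans {i : Fin m} {r r' r'' : Fin N} {ℓ ℓ' : ℝ} (h : HubRoute O c i r r' ℓ)
    (h' : HubRoute O c i r' r'' ℓ') : HubRoute O c i r r'' (ℓ + ℓ') := by
  obtain ⟨k, hk⟩ := h
  obtain ⟨l, hl⟩ := HubRoute.route (a := (k, r')) h'
  exact (hk.trans hl).hubRoute

lemma Visible.hubRoute (hm : 2 ≤ m) (hO : IsObstacleFamily O) (i : Fin m) {a b : Label m N}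
    (h : Visible O a b) : ∃ ℓ, HubRoute O c i a.2 b.2 ℓ := by
  obtain ⟨ℓ, -, d, hr, hp⟩ := h.hub_route (c := c) hm hO i
  obtain ⟨ℓ', -, hr'⟩ := h.route_hub (c := c) hm hO i
  exact ⟨_, ((hr.step hp).trans hr').hubRoute⟩

/-- Visibility is symmetric, so the walk can be followed backwards, with a detour at each obstacle.
Only existence matters here; a uniform length comes from `exists_hubRoute_bound`. -/
lemma exists_hubRoute_of_walk (hm : 2 ≤ m) (hO : IsObstacleFamily O) (i : Fin m)
    {s : ℕ → Label m N} {p : ℕ} (hs : ∀ n ≤ p, Visible O (s n) (s (n + 1))) :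
    ∃ ℓ, HubRoute O c i (s (p + 1)).2 (s 0).2 ℓ := by
  induction p with
  | zero => exact (hs 0 le_rfl).symm.hubRoute hm hO i
  | succ p ih =>
    obtain ⟨ℓ, hℓ⟩ := ih fun n hn => hs n (by omega)
    obtain ⟨ℓ', hℓ'⟩ := (hs (p + 1) le_rfl).symm.hubRoute (c := c) hm hO i
    exact ⟨_, hℓ'.trans hℓ⟩

/-- One length is chosen for each connected pair of types, and there are finitely many pairs. -/
lemma exists_hubRoute_bound (O : Fin N → Set (Space m)) (c : Fin N → Space m) (i : Fin m) :
    ∃ C, ∀ r r' ℓ, HubRoute O c i r r' ℓ → ∃ ℓ' ≤ C, HubRoute O c i r r' ℓ' := by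
  classical
  let f : Fin N × Fin N → ℝ := fun x =>
    if h : ∃ ℓ, HubRoute O c i x.1 x.2 ℓ then h.choose else 0
  obtain ⟨C, hC⟩ := (Set.finite_range f).bddAbove
  refine ⟨C, fun r r' ℓ hℓ => ⟨f (r, r'), hC ⟨_, rfl⟩, ?_⟩⟩
  have h : ∃ ℓ, HubRoute O c i r r' ℓ := ⟨ℓ, hℓ⟩
  simp only [f]
  rw [dif_pos h]
  exact h.choose_spec

/-- A finite admissible sequence can be closed up by a sequence of bounded length. -/
lemma exists_closing_route (hm : 2 ≤ m) (hO : IsObstacleFamily O) (c : Fin N → Space m) :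
    ∃ C, ∀ (s : ℕ → Label m N) (p : ℕ), (∀ n ≤ p, Visible O (s n) (s (n + 1))) →
      ∃ ℓ ≤ C, ∃ (K : Fin m → ℤ) (d : Label m N),
        Route O c (s p) (s (p + 1)) d (shift K (s 0)) ℓ ∧
        Passes O d (shift K (s 0)) (shift K (s 1)) := by
  let i : Fin m := ⟨0, by omega⟩
  obtain ⟨C, hC⟩ := exists_hubRoute_bound O c i
  refine ⟨5 + C + 5, fun s p hs => ?_⟩
  obtain ⟨ℓ₀, h₀⟩ := exists_hubRoute_of_walk (c := c) hm hO i hs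
  obtain ⟨ℓ, hℓ, hr⟩ := hC _ _ _ h₀
  obtain ⟨k, hk⟩ := hr.route
  obtain ⟨ℓ₁, hℓ₁, hr₁⟩ := (hs p le_rfl).route_hub (c := c) hm hO i
  -- The first edge of `s` is translated to start at the obstacle where the hub route ended.
  obtain ⟨ℓ₂, hℓ₂, d, hr₂, hp₂⟩ :=
    ((hs 0 (Nat.zero_le _)).shift (k - (s 0).1)).hub_route (c := c) hm hO i
  have he : shift (k - (s 0).1) (s 0) = (k, (s 0).2) := by simp [shift]
  rw [← he] at hk
  exact ⟨_, by linarith, _, d, (hr₁.trans hk).trans hr₂, hp₂⟩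

/-! ### Periodic extension of finite admissible sequences -/

lemma exists_periodic_of_closed {t : ℕ → Label m N} {q : ℕ} (hq : 2 ≤ q) {K : Fin m → ℤ}
    (h0 : t q = shift K (t 0)) (h1 : t (q + 1) = shift K (t 1))
    (ht : ∀ j < q, Passes O (t j) (t (j + 1)) (t (j + 2))) :
    ∃ s : ℕ → Label m N, (∀ j ≤ q, s j = t j) ∧ (∀ n, s (n + q) = shift K (s n)) ∧
      ∀ n, Passes O (s n) (s (n + 1)) (s (n + 2)) := by
  let s : ℕ → Label m N := fun n => shift ((n / q) • K) (t (n % q))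
  have hper : ∀ n, s (n + q) = shift K (s n) := by
    intro n
    simp only [s]
    rw [Nat.add_div_right _ (by omega), Nat.add_mod_right, shift_shift, succ_nsmul]
  have hlt : ∀ j < q, s j = t j := by
    intro j hj
    simp [s, Nat.div_eq_of_lt hj, Nat.mod_eq_of_lt hj]
  -- Triples starting before `q` reach up to index `q + 1`; there `2 ≤ q` is used to have `1 < q`.
  have hle : ∀ j ≤ q + 1, s j = t j := by
    intro j hj
    rcases lt_or_ge j q with h | h
    · exact hlt j h
    · rcases (by omega : j = q ∨ j = q + 1) with rfl | rfl
      · rw [← zero_add j, hper, hlt _ (by omega), zero_add, h0]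
      · rw [add_comm, hper, hlt _ (by omega), add_comm, h1]
  refine ⟨s, fun j hj => hle j (by omega), hper, fun n => ?_⟩
  induction n using Nat.strong_induction_on with
  | _ n ih =>
    rcases lt_or_ge n q with h | h
    · rw [hle n (by omega), hle (n + 1) (by omega), hle (n + 2) (by omega)]
      exact ht n h
    · obtain ⟨l, rfl⟩ := Nat.exists_eq_add_of_le' h
      have h2 := (ih l (by omega)).shift K
      rwa [← hper, ← hper, ← hper, add_right_comm, add_right_comm l 2 q] at h2

/-- A finite admissible sequence has a periodic extension with bounded additional length. -/
lemma exists_periodic_extension (hm : 2 ≤ m) (hO : IsObstacleFamily O) (c : Fin N → Space m) :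
    ∃ C, ∀ (s : ℕ → Label m N) (p : ℕ), (∀ n ≤ p, Visible O (s n) (s (n + 1))) →
      (∀ n < p, Passes O (s n) (s (n + 1)) (s (n + 2))) →
      ∃ (l : ℕ) (K : Fin m → ℤ) (s' : ℕ → Label m N), 0 < l ∧ (∀ j ≤ p + 1, s' j = s j) ∧
        (∀ n, s' (n + (p + 1 + l)) = shift K (s' n)) ∧
        (∀ n, Passes O (s' n) (s' (n + 1)) (s' (n + 2))) ∧
        ∑ j ∈ Finset.range l, dist (rep c (s' (p + 1 + j))) (rep c (s' (p + 1 + j + 1))) ≤ C := by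
  obtain ⟨C, hC⟩ := exists_closing_route hm hO c
  refine ⟨C, fun s p hs hp => ?_⟩
  obtain ⟨ℓ, hℓ, K, d, hr, hlast⟩ := hC s p hs
  obtain ⟨n, w, hw0, hw1, hwd, hwK, hw, hsum⟩ := hr.exists_seq
  -- The sequence and the closing route overlap in the edge at `p`, `p + 1`; one further label
  -- repeats the first edge of `s`, translated by `K`.
  obtain ⟨t, hts, htw, htK⟩ : ∃ t : ℕ → Label m N, (∀ j ≤ p + 1, t j = s j) ∧
      (∀ j ≤ n + 2, t (p + j) = w j) ∧ t (p + (n + 3)) = shift K (s 1) := by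
    refine ⟨fun j => if j ≤ p + 1 then s j else if j ≤ p + (n + 2) then w (j - p)
      else shift K (s 1), fun j hj => if_pos hj, fun j hj => ?_, ?_⟩
    · rcases (by omega : j = 0 ∨ j = 1 ∨ 2 ≤ j) with rfl | rfl | h
      · simp [hw0]
      · simp [hw1]
      · simp only
        rw [if_neg (by omega), if_pos (by omega), Nat.add_sub_cancel_left]
    · simp only
      rw [if_neg (by omega), if_neg (by omega)]
  obtain ⟨s', hs't, hper, hpass⟩ := exists_periodic_of_closed (O := O) (t := t)
    (q := p + 1 + (n + 1)) (by omega) (K := K)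
    (by rw [show p + 1 + (n + 1) = p + (n + 2) by omega, htw _ le_rfl, hwK, hts 0 (by omega)])
    (by rw [show p + 1 + (n + 1) + 1 = p + (n + 3) by omega, htK, hts 1 (by omega)])
    (by
      intro j hj
      rcases lt_or_ge j p with h | h
      · rw [hts _ (by omega), hts _ (by omega), hts _ (by omega)]
        exact hp j h
      · obtain ⟨i, rfl⟩ := Nat.exists_eq_add_of_le h
        rcases (by omega : i ≤ n ∨ i = n + 1) with hi | rfl
        · rw [add_assoc, add_assoc, htw _ (by omega), htw _ (by omega), htw _ (by omega)]
          exact hw i hi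
        · rw [show p + (n + 1) + 1 = p + (n + 2) by omega,
            show p + (n + 1) + 2 = p + (n + 3) by omega, htw _ (by omega), htw _ le_rfl, htK,
            hwd, hwK]
          exact hlast)
  refine ⟨n + 1, K, s', by omega, fun j hj => ?_, hper, hpass, ?_⟩
  · rw [hs't j (by omega), hts j hj]
  · refine le_trans (le_of_eq ?_) hℓ
    rw [← hsum]
    refine Finset.sum_congr rfl fun j hj => ?_
    rw [Finset.mem_range] at hj
    rw [hs't _ (by omega), hs't _ (by omega), show p + 1 + j = p + (j + 1) by omega,
      show p + (j + 1) + 1 = p + (j + 2) by omega, htw _ (by omega), htw _ (by omega)]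

/-! ### Reflection at a shortest path -/

/-- A second order bound without differentiation: it is `2‖u‖‖u + t • d‖ ≤ ‖u‖² + ‖u + t • d‖²`,
divided by `2‖u‖`. -/
lemma norm_add_smul_le {E : Type*} [NormedAddCommGroup E] [InnerProductSpace ℝ E] {u : E}
    (hu : u ≠ 0) (d : E) (t : ℝ) :
    ‖u + t • d‖ ≤ ‖u‖ + t * inner ℝ (‖u‖⁻¹ • u) d + t ^ 2 * (‖d‖ ^ 2 / (2 * ‖u‖)) := by
  have hu' : 0 < ‖u‖ := norm_pos_iff.2 hu
  have h1 : ‖u + t • d‖ ^ 2 = ‖u‖ ^ 2 + 2 * (t * inner ℝ u d) + t ^ 2 * ‖d‖ ^ 2 := by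
    rw [norm_add_sq_real, inner_smul_right, norm_smul, mul_pow, Real.norm_eq_abs, sq_abs]
  rw [inner_smul_left]
  simp only [conj_trivial]
  have h2 : ‖u‖ + t * (‖u‖⁻¹ * inner ℝ u d) + t ^ 2 * (‖d‖ ^ 2 / (2 * ‖u‖)) =
      (‖u‖ ^ 2 + ‖u + t • d‖ ^ 2) / (2 * ‖u‖) := by
    rw [h1]; field_simp; ring
  rw [h2, le_div_iff₀ (by positivity)]
  nlinarith [sq_nonneg (‖u + t • d‖ - ‖u‖)]

/-- First order condition for a shortest path via a convex set. -/
lemma inner_direction_sub_nonneg {S : Set (Space m)} (hS : Convex ℝ S) {a b x : Space m}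
    (hx : x ∈ S) (ha : x ≠ a) (hb : x ≠ b)
    (hmin : ∀ y ∈ S, dist a x + dist x b ≤ dist a y + dist y b) {y : Space m} (hy : y ∈ S) :
    0 ≤ inner ℝ (direction a x - direction x b) (y - x) := by
  set d := y - x with hd
  set M := ‖d‖ ^ 2 / (2 * ‖x - a‖) + ‖d‖ ^ 2 / (2 * ‖x - b‖) with hM
  have hM0 : 0 ≤ M := by positivity
  have key : ∀ t ∈ Ioc (0 : ℝ) 1, 0 ≤ inner ℝ (direction a x - direction x b) d + t * M := by
    intro t ht
    have h1 := norm_add_smul_le (sub_ne_zero.2 ha) d t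
    have h2 := norm_add_smul_le (sub_ne_zero.2 hb) d t
    have h3 := hmin (x + t • d) (hS.add_smul_sub_mem hx hy ⟨ht.1.le, ht.2⟩)
    rw [dist_comm a x, dist_comm a, dist_eq_norm, dist_eq_norm, dist_eq_norm, dist_eq_norm,
      add_sub_right_comm, add_sub_right_comm] at h3
    have h4 : direction x b = -(‖x - b‖⁻¹ • (x - b)) := by
      rw [direction, norm_sub_rev, ← smul_neg, neg_sub]
    rw [h4, sub_neg_eq_add, inner_add_left, direction]
    have h5 : 0 ≤ t * (inner ℝ (‖x - a‖⁻¹ • (x - a)) d + inner ℝ (‖x - b‖⁻¹ • (x - b)) d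
        + t * M) := by
      rw [hM]; linarith
    exact nonneg_of_mul_nonneg_right h5 ht.1
  by_contra! hneg
  set G := inner ℝ (direction a x - direction x b) d
  -- This `t` makes the quadratic error at most `-G / 2`; `M + 1` avoids dividing by zero.
  have ht : 0 < min 1 (-G / (2 * (M + 1))) := lt_min one_pos (by apply div_pos <;> linarith)
  have h := key _ ⟨ht, min_le_left _ _⟩
  have h1 : min 1 (-G / (2 * (M + 1))) * M ≤ -G / 2 := by
    calc _ ≤ -G / (2 * (M + 1)) * M := by gcongr; exact min_le_right _ _
      _ ≤ -G / (2 * (M + 1)) * (M + 1) := by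
        gcongr
        · apply div_nonneg <;> linarith
        · linarith
      _ = -G / 2 := by field_simp
  linarith

lemma norm_direction {x y : Space m} (h : x ≠ y) : ‖direction x y‖ = 1 := by
  have : ‖y - x‖ ≠ 0 := norm_ne_zero_iff.2 (sub_ne_zero.2 h.symm)
  rw [direction, norm_smul, norm_inv, norm_norm, inv_mul_cancel₀ this]

lemma dist_smul_direction (x y : Space m) : dist x y • direction x y = y - x := by
  rcases eq_or_ne x y with rfl | h
  · simp [direction]
  · have : ‖y - x‖ ≠ 0 := norm_ne_zero_iff.2 (sub_ne_zero.2 h.symm)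
    rw [direction, dist_comm, dist_eq_norm, smul_smul, mul_inv_cancel₀ this, one_smul]

lemma mem_segment_of_direction_eq {a b x : Space m}
    (h : direction a x = direction x b) : x ∈ segment ℝ a b := by
  have h1 : SameRay ℝ (x - a) (b - x) := by
    rw [← dist_smul_direction a x, ← dist_smul_direction x b, h]
    exact (SameRay.sameRay_nonneg_smul_left _ dist_nonneg).nonneg_smul_right dist_nonneg
  rw [← mem_segment_iff_sameRay] at h1
  exact h1

/-- A shortest path via a convex set that it does not cross is reflected. -/
lemma exists_normal_of_isMin {S : Set (Space m)} (hS : Convex ℝ S) {a b x : Space m}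
    (hx : x ∈ S) (ha : x ≠ a) (hb : x ≠ b) (hseg : x ∉ segment ℝ a b)
    (hmin : ∀ y ∈ S, dist a x + dist x b ≤ dist a y + dist y b) :
    ∃ ν, IsOutwardNormal S x ν ∧
      direction x b = direction a x - (2 * inner ℝ (direction a x) ν) • ν ∧
      0 ≤ inner ℝ ν (a - x) ∧ 0 ≤ inner ℝ ν (b - x) := by
  set v := direction a x with hv
  set w := direction x b with hw
  have hvn : ‖v‖ = 1 := norm_direction ha.symm
  have hwn : ‖w‖ = 1 := norm_direction hb
  have hne : w - v ≠ 0 := sub_ne_zero.2 fun h => hseg (mem_segment_of_direction_eq h.symm)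
  have hpos : 0 < ‖w - v‖ := norm_pos_iff.2 hne
  have hsq : ‖w - v‖ ^ 2 = 2 - 2 * inner ℝ v w := by
    rw [norm_sub_sq_real, hvn, hwn, real_inner_comm]; ring
  have h1 : inner ℝ v (w - v) = -(‖w - v‖ ^ 2 / 2) := by
    rw [inner_sub_right, real_inner_self_eq_norm_sq, hvn, hsq]; ring
  have h2 : inner ℝ w (w - v) = ‖w - v‖ ^ 2 / 2 := by
    rw [inner_sub_right, real_inner_self_eq_norm_sq, hwn, hsq, real_inner_comm]; ring
  -- The normal is the normalised change of velocity, nonzero because the path does not go straight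
  -- through `x`.
  refine ⟨‖w - v‖⁻¹ • (w - v), ⟨?_, fun y hy => ?_⟩, ?_, ?_, ?_⟩
  · rw [norm_smul, norm_inv, norm_norm, inv_mul_cancel₀ hpos.ne']
  · have h := inner_direction_sub_nonneg hS hx ha hb hmin hy
    rw [← neg_sub, inner_neg_left] at h
    rw [inner_smul_left]
    exact mul_nonpos_of_nonneg_of_nonpos (by simp) (by linarith)
  · rw [inner_smul_right, h1, smul_smul]
    have : 2 * (‖w - v‖⁻¹ * -(‖w - v‖ ^ 2 / 2)) * ‖w - v‖⁻¹ = -1 := by field_simp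
    rw [this]; simp
  · rw [← neg_sub x a, ← dist_smul_direction a x, inner_neg_right, inner_smul_left, inner_smul_right,
      real_inner_comm, ← hv, h1]
    simp only [conj_trivial]
    have : 0 ≤ ‖w - v‖⁻¹ * (dist a x * (‖w - v‖ ^ 2 / 2)) := by positivity
    linarith
  · rw [← dist_smul_direction x b, inner_smul_left, inner_smul_right,
      real_inner_comm, ← hw, h2]
    simp only [conj_trivial]
    positivity

/-! ### Normals and the billiard domain -/

lemma inner_lt_of_mem_interior {S : Set (Space m)} {x ν z : Space m} (hν : IsOutwardNormal S x ν)
    (hz : z ∈ interior S) : inner ℝ ν (z - x) < 0 := by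
  rw [mem_interior_iff_mem_nhds, Metric.mem_nhds_iff] at hz
  obtain ⟨ε, hε, hball⟩ := hz
  have h := hν.2 (z + (ε / 2) • ν) (hball (by
    rw [Metric.mem_ball, dist_self_add_left, norm_smul, hν.1, Real.norm_eq_abs, abs_of_pos] <;>
      linarith))
  rw [add_sub_right_comm, inner_add_right, inner_smul_right, real_inner_self_eq_norm_sq,
    hν.1] at h
  linarith

lemma IsOutwardNormal.mem_frontier {S : Set (Space m)} {x ν : Space m}
    (hν : IsOutwardNormal S x ν) (hx : x ∈ S) : x ∈ frontier S := by
  refine ⟨subset_closure hx, fun h => ?_⟩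
  have := inner_lt_of_mem_interior hν h
  simp at this

/-- A neighbourhood of `z ∈ O_a` that meets no other obstacle. -/
lemma eventually_mem_lifted_imp_eq (hO : IsObstacleFamily O) {a : Label m N} {z : Space m}
    (hz : z ∈ lifted O a) : ∀ᶠ y in 𝓝 z, ∀ b, y ∈ lifted O b → y ∈ lifted O a := by
  have hcube : ∀ᶠ y : Space m in 𝓝 z, ∀ i, (a.1 i : ℝ) < y i ∧ y i < a.1 i + 1 := by
    rw [eventually_all]
    intro i
    have hc : Continuous fun y : Space m => y i := by fun_prop
    have h := hO.mem_cube_lifted hz i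
    exact ((hc.tendsto z).eventually_const_lt h.1).and ((hc.tendsto z).eventually_lt_const h.2)
  have hother : ∀ᶠ y in 𝓝 z, ∀ r, r ≠ a.2 → y ∉ lifted O (a.1, r) := by
    rw [eventually_all]
    intro r
    rcases eq_or_ne r a.2 with rfl | hr
    · simp
    · have hzr : z ∉ lifted O (a.1, r) := by
        intro h
        rw [mem_lifted] at hz h
        exact (hO.disjoint _ _ hr).le_bot ⟨h, hz⟩
      filter_upwards [(hO.isCompact_lifted (a.1, r)).isClosed.isOpen_compl.mem_nhds hzr]
        with y hy _ using hy
  filter_upwards [hcube, hother] with y h1 h2 b hb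
  have hb1 : b.1 = a.1 := by
    ext i
    have h3 := hO.mem_cube_lifted hb i
    have h4 : (a.1 i : ℝ) < b.1 i + 1 := by linarith [(h1 i).1]
    have h5 : (b.1 i : ℝ) < a.1 i + 1 := by linarith [(h1 i).2]
    have h4' : a.1 i < b.1 i + 1 := by exact_mod_cast h4
    have h5' : b.1 i < a.1 i + 1 := by exact_mod_cast h5
    omega
  obtain ⟨b1, b2⟩ := b
  obtain rfl : b1 = a.1 := hb1
  by_cases hr : b2 = a.2
  · subst hr; exact hb
  · exact absurd hb (h2 b2 hr)

/-- Near a point of one obstacle there are no others, so the interior of the union is the union of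
the interiors. -/
lemma mem_domain_iff (hO : IsObstacleFamily O) {z : Space m} :
    z ∈ domain O ↔ ∀ a, z ∉ interior (lifted O a) := by
  rw [domain, closure_compl, mem_compl_iff]
  constructor
  · exact fun h a ha => h (interior_mono (subset_iUnion _ a) ha)
  · intro h hz
    obtain ⟨a, hza⟩ := mem_iUnion.1 (interior_subset hz)
    apply h a
    rw [mem_interior_iff_mem_nhds] at hz ⊢
    filter_upwards [hz, eventually_mem_lifted_imp_eq hO hza] with y hy hy'
    obtain ⟨b, hb⟩ := mem_iUnion.1 hy
    exact hy' b hb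

/-- A segment between visible obstacles that leaves both of them outwards lies in the domain. -/
lemma segment_subset_domain (hO : IsObstacleFamily O) {a b : Label m N} (hab : Visible O a b)
    {x y ν ν' : Space m} (hx : x ∈ lifted O a) (hy : y ∈ lifted O b)
    (hν : IsOutwardNormal (lifted O a) x ν) (hν' : IsOutwardNormal (lifted O b) y ν')
    (h : 0 ≤ inner ℝ ν (y - x)) (h' : 0 ≤ inner ℝ ν' (x - y)) :
    segment ℝ x y ⊆ domain O := by
  have key : ∀ x y ν : Space m, ∀ S, IsOutwardNormal S x ν → 0 ≤ inner ℝ ν (y - x) →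
      ∀ z ∈ segment ℝ x y, z ∉ interior S := by
    intro x y ν S hν h z hz hzi
    have h1 := inner_lt_of_mem_interior hν hzi
    rw [segment_eq_image'] at hz
    obtain ⟨t, ht, rfl⟩ := hz
    rw [add_sub_cancel_left, inner_smul_right] at h1
    nlinarith [mul_nonneg ht.1 h]
  intro z hz
  rw [mem_domain_iff hO]
  intro e he
  by_cases hea : e = a
  · subst hea; exact key _ _ _ _ hν h z hz he
  by_cases heb : e = b
  · subst heb; exact key _ _ _ _ hν' h' z (segment_symm ℝ x y ▸ hz) he
  · exact hab.2 e ⟨hea, heb, z, interior_subset he,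
      (convex_convexHull ℝ _).segment_subset (subset_convexHull ℝ _ (.inl hx))
        (subset_convexHull ℝ _ (.inr hy)) hz⟩

/-! ### Periodic trajectories -/

/-- The sequences of points of the obstacles `s 0, s 1, …` that are periodic on the torus. -/
def periodicPaths (O : Fin N → Set (Space m)) (s : ℕ → Label m N) (q : ℕ) (K : Fin m → ℤ) :
    Set (ℕ → Space m) :=
  {x | (∀ n, x n ∈ lifted O (s n)) ∧ ∀ n, x (n + q) = x n + latticeVec K}

lemma isCompact_periodicPaths (hO : IsObstacleFamily O) (s : ℕ → Label m N) (q : ℕ)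
    (K : Fin m → ℤ) : IsCompact (periodicPaths O s q K) := by
  have h1 : IsCompact (Set.pi univ fun n => lifted O (s n)) :=
    isCompact_univ_pi fun n => hO.isCompact_lifted _
  have h2 : IsClosed {x : ℕ → Space m | ∀ n, x (n + q) = x n + latticeVec K} := by
    simp only [ofPred_forall]
    exact isClosed_iInter fun n => isClosed_eq (by fun_prop) (by fun_prop)
  convert h1.inter_right h2 using 1
  ext x
  simp [periodicPaths]

lemma sum_range_add_of_periodic {f : ℕ → ℝ} {q : ℕ} (hf : ∀ n, f (n + q) = f n) (n : ℕ) :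
    ∑ j ∈ Finset.range q, f (n + j) = ∑ j ∈ Finset.range q, f j := by
  induction n with
  | zero => simp
  | succ n ih =>
    rw [← ih]
    have h1 := Finset.sum_range_succ (fun j => f (n + j)) q
    rw [Finset.sum_range_succ', add_zero, hf] at h1
    simpa [add_assoc, add_comm 1] using h1

lemma dist_periodic {x : ℕ → Space m} {q : ℕ} {K : Fin m → ℤ}
    (hx : ∀ n, x (n + q) = x n + latticeVec K) (n : ℕ) :
    dist (x (n + q)) (x (n + q + 1)) = dist (x n) (x (n + 1)) := by
  rw [add_right_comm, hx, hx, dist_add_right]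

lemma eq_shift_mod {s : ℕ → Label m N} {q : ℕ} {K : Fin m → ℤ}
    (hs : ∀ n, s (n + q) = shift K (s n)) (n : ℕ) : s n = shift ((n / q) • K) (s (n % q)) := by
  have key : ∀ l r : ℕ, s (r + q * l) = shift (l • K) (s r) := by
    intro l r
    induction l with
    | zero => simp
    | succ l ih => rw [mul_add_one, ← add_assoc, hs, ih, succ_nsmul, shift_shift]
  rw [← key, Nat.mod_add_div]

lemma eq_add_mod {x : ℕ → Space m} {q : ℕ} {K : Fin m → ℤ}
    (hx : ∀ n, x (n + q) = x n + latticeVec K) (n : ℕ) :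
    x n = x (n % q) + latticeVec ((n / q) • K) := by
  have key : ∀ l r : ℕ, x (r + q * l) = x r + latticeVec (l • K) := by
    intro l r
    induction l with
    | zero => simp
    | succ l ih => rw [mul_add_one, ← add_assoc, hx, ih, succ_nsmul, latticeVec_add, add_assoc]
  rw [← key, Nat.mod_add_div]

lemma eq_of_mod_eq {s : ℕ → Label m N} {q : ℕ} {K : Fin m → ℤ} {x : ℕ → Space m}
    (hs : ∀ n, s (n + q) = shift K (s n)) (hx : ∀ n, x (n + q) = x n + latticeVec K)
    {i j : ℕ} (h : j % q = i % q) :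
    ∃ k : Fin m → ℤ, s j = shift k (s i) ∧ x j = x i + latticeVec k := by
  refine ⟨-((i / q) • K) + (j / q) • K, ?_, ?_⟩
  · rw [eq_shift_mod hs j, eq_shift_mod hs i, shift_shift, h, add_neg_cancel_left]
  · rw [eq_add_mod hx j, eq_add_mod hx i, h, latticeVec_add, latticeVec_neg]
    abel

lemma exists_periodicPath_extending {s : ℕ → Label m N} {q : ℕ} (hq : 0 < q) {K : Fin m → ℤ}
    (hs : ∀ n, s (n + q) = shift K (s n)) {t : ℕ → Space m}
    (ht : ∀ n < q, t n ∈ lifted O (s n)) :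
    ∃ y ∈ periodicPaths O s q K, ∀ n < q, y n = t n := by
  refine ⟨fun n => t (n % q) + latticeVec ((n / q) • K), ⟨fun n => ?_, fun n => ?_⟩,
    fun n hn => ?_⟩
  · rw [eq_shift_mod hs n, add_mem_lifted_shift]
    exact ht _ (Nat.mod_lt _ hq)
  · simp only [Nat.add_mod_right, Nat.add_div_right _ hq, succ_nsmul,
      latticeVec_add, add_assoc]
  · simp [Nat.mod_eq_of_lt hn, Nat.div_eq_of_lt hn]

/-- A shortest periodic path is shortest between the neighbours of any of its points. -/
lemma dist_add_dist_le_of_isMinOn {s : ℕ → Label m N} {q : ℕ} (hq : 2 ≤ q) {K : Fin m → ℤ}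
    (hs : ∀ n, s (n + q) = shift K (s n)) {x : ℕ → Space m} (hx : x ∈ periodicPaths O s q K)
    (hmin : ∀ y ∈ periodicPaths O s q K, pathLength x q ≤ pathLength y q) (n : ℕ)
    {y : Space m} (hy : y ∈ lifted O (s (n + 1))) :
    dist (x n) (x (n + 1)) + dist (x (n + 1)) (x (n + 2)) ≤
      dist (x n) y + dist y (x (n + 2)) := by
  -- All points congruent to `n + 1` modulo `q` are moved by the same vector, which keeps the path
  -- periodic; `2 ≤ q` leaves the neighbours fixed.
  let x' : ℕ → Space m := fun j => if j % q = (n + 1) % q then x j + (y - x (n + 1)) else x j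
  have hx' : x' ∈ periodicPaths O s q K := by
    refine ⟨fun j => ?_, fun j => ?_⟩
    · by_cases hj : j % q = (n + 1) % q
      · simp only [x', if_pos hj]
        obtain ⟨k, hk, hk'⟩ := eq_of_mod_eq hs hx.2 hj
        rw [hk, hk', mem_lifted_shift]
        convert hy using 1
        abel
      · simp only [x', if_neg hj]
        exact hx.1 j
    · by_cases hj : j % q = (n + 1) % q
      · simp only [x', Nat.add_mod_right, if_pos hj, hx.2]
        abel
      · simp only [x', Nat.add_mod_right, if_neg hj, hx.2]
  have hself : x' (n + 1) = y := by simp [x']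
  have hother : ∀ i, 0 < i → i < q → x' (n + 1 + i) = x (n + 1 + i) := by
    intro i hi hiq
    refine if_neg fun h => ?_
    have h1 : n + 1 + i ≡ n + 1 + 0 [MOD q] := h
    have h2 := (Nat.modEq_zero_iff_dvd.1 h1.add_left_cancel')
    exact absurd (Nat.le_of_dvd hi h2) (by omega)
  have hprev : x' n = x n := by
    refine if_neg fun h => ?_
    have h1 : n + 0 ≡ n + 1 [MOD q] := h
    have h2 := (Nat.modEq_zero_iff_dvd.1 h1.add_left_cancel'.symm)
    exact absurd (Nat.le_of_dvd one_pos h2) (by omega)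
  have h := hmin x' hx'
  unfold pathLength at h
  rw [← sum_range_add_of_periodic (f := fun j => dist (x j) (x (j + 1))) (dist_periodic hx.2) n,
    ← sum_range_add_of_periodic (f := fun j => dist (x' j) (x' (j + 1))) (dist_periodic hx'.2) n]
    at h
  -- With the period window starting at `n`, only the first two terms change.
  obtain ⟨l, rfl⟩ := Nat.exists_eq_add_of_le' hq
  rw [Finset.sum_range_succ', Finset.sum_range_succ', Finset.sum_range_succ',
    Finset.sum_range_succ'] at h
  have hrest : ∑ j ∈ Finset.range l, dist (x' (n + (j + 1 + 1))) (x' (n + (j + 1 + 1) + 1)) =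
      ∑ j ∈ Finset.range l, dist (x (n + (j + 1 + 1))) (x (n + (j + 1 + 1) + 1)) := by
    refine Finset.sum_congr rfl fun j hj => ?_
    rw [Finset.mem_range] at hj
    rw [show n + (j + 1 + 1) + 1 = n + 1 + (j + 2) by omega,
      show n + (j + 1 + 1) = n + 1 + (j + 1) by omega, hother _ (by omega) (by omega),
      hother _ (by omega) (by omega)]
  have h2 : x' (n + 2) = x (n + 2) := hother 1 one_pos (by omega)
  rw [hrest] at h
  simp only [zero_add, add_zero] at h
  rw [show n + 1 + 1 = n + 2 from rfl, hprev, hself, h2] at h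
  linarith

lemma IsOutwardNormal.shift {a : Label m N} {k : Fin m → ℤ} {x ν : Space m}
    (h : IsOutwardNormal (lifted O (shift k a)) (x + latticeVec k) ν) :
    IsOutwardNormal (lifted O a) x ν := by
  refine ⟨h.1, fun y hy => ?_⟩
  have := h.2 _ (add_mem_lifted_shift.2 hy)
  rwa [add_sub_add_right_eq_sub] at this

/-- A shortest periodic path of admissible type is a billiard trajectory. -/
lemma isTrajectoryOfType_of_isMinOn (hm : 2 ≤ m) (hO : IsObstacleFamily O) {s : ℕ → Label m N}
    {q : ℕ} (hq : 2 ≤ q) {K : Fin m → ℤ} (hs : ∀ n, s (n + q) = shift K (s n))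
    (hpass : ∀ n, Passes O (s n) (s (n + 1)) (s (n + 2)))
    {x : ℕ → Space m} (hx : x ∈ periodicPaths O s q K)
    (hmin : ∀ y ∈ periodicPaths O s q K, pathLength x q ≤ pathLength y q) :
    IsTrajectoryOfType O ⊤ s x := by
  have hne : ∀ n, x (n + 1) ≠ x n := by
    intro n h
    exact (hO.disjoint_lifted hm (hpass n).fst.1).le_bot ⟨hx.1 (n + 1), h ▸ hx.1 n⟩
  have hnormal : ∀ n, ∃ ν, IsOutwardNormal (lifted O (s (n + 1))) (x (n + 1)) ν ∧
      direction (x (n + 1)) (x (n + 2)) = direction (x n) (x (n + 1)) -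
        (2 * inner ℝ (direction (x n) (x (n + 1))) ν) • ν ∧
      0 ≤ inner ℝ ν (x n - x (n + 1)) ∧ 0 ≤ inner ℝ ν (x (n + 2) - x (n + 1)) := by
    intro n
    refine exists_normal_of_isMin (hO.convex_lifted _) (hx.1 _) (hne n) (hne (n + 1)).symm ?_
      fun y hy => dist_add_dist_le_of_isMinOn hq hs hx hmin n hy
    intro hseg
    refine (hpass n).not_between ⟨(hpass n).fst.1, (hpass n).snd.1.symm, _, hx.1 (n + 1), ?_⟩
    exact (convex_convexHull ℝ _).segment_subset (subset_convexHull ℝ _ (.inl (hx.1 n)))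
      (subset_convexHull ℝ _ (.inr (hx.1 (n + 2)))) hseg
  have hout : ∀ n, ∃ ν, IsOutwardNormal (lifted O (s n)) (x n) ν ∧
      0 ≤ inner ℝ ν (x (n + 1) - x n) := by
    intro n
    -- Index 0 has no predecessor, so its normal is found one period later and translated back.
    obtain ⟨ν, h1, -, -, h2⟩ := hnormal (n + q - 1)
    rw [show n + q - 1 + 1 = n + q by omega, hs, hx.2] at h1
    rw [show n + q - 1 + 1 = n + q by omega, show n + q - 1 + 2 = n + 1 + q by omega, hx.2, hx.2,
      add_sub_add_right_eq_sub] at h2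
    exact ⟨ν, h1.shift, h2⟩
  refine ⟨fun n _ => ?_, fun n _ => ?_, fun n _ => ?_⟩
  · obtain ⟨ν, h, -⟩ := hout n
    exact h.mem_frontier (hx.1 n)
  · obtain ⟨ν, h, h'⟩ := hout n
    obtain ⟨ν', h2, -, h2', -⟩ := hnormal n
    exact segment_subset_domain hO (hpass n).fst (hx.1 n) (hx.1 (n + 1)) h h2 h' h2'
  · obtain ⟨ν, h1, h2, -⟩ := hnormal n
    exact ⟨ν, h1, h2⟩

lemma exists_shortest_periodicPath (hO : IsObstacleFamily O) {c : Fin N → Space m}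
    (hc : ∀ r, c r ∈ O r) {s : ℕ → Label m N} {q : ℕ} {K : Fin m → ℤ}
    (hs : ∀ n, s (n + q) = shift K (s n)) :
    ∃ x ∈ periodicPaths O s q K, ∀ y ∈ periodicPaths O s q K, pathLength x q ≤ pathLength y q := by
  have hne : (periodicPaths O s q K).Nonempty := by
    refine ⟨fun n => rep c (s n), fun n => ?_, fun n => ?_⟩
    · exact ⟨_, hc _, rfl⟩
    · simp only [hs, rep_shift]
  have hcont : Continuous fun x : ℕ → Space m => pathLength x q := by
    unfold pathLength; fun_prop
  exact (isCompact_periodicPaths hO s q K).exists_isMinOn hne hcont.continuousOn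

/-! ### Trajectory pieces are shortest paths -/

/-- Directions in which a defining function decreases do not point outwards. -/
lemma inner_nonpos_of_fderiv_neg {S : Set (Space m)} (hS : IsClosed S) {x : Space m}
    {U : Set (Space m)} (hU : IsOpen U) (hxU : x ∈ U) {g : Space m → ℝ}
    (hg : DifferentiableAt ℝ g x) (hSU : S ∩ U = {y | y ∈ U ∧ g y ≤ 0}) (hx : x ∈ frontier S)
    {ν : Space m} (hν : IsOutwardNormal S x ν) {w : Space m} (hw : fderiv ℝ g x w < 0) :
    inner ℝ ν w ≤ 0 := by
  have hxS : x ∈ S := hS.frontier_subset hx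
  have hgx : g x = 0 := by
    have h1 : x ∈ S ∩ U := ⟨hxS, hxU⟩
    rw [hSU] at h1
    refine le_antisymm h1.2 (not_lt.1 fun h => hx.2 ?_)
    rw [mem_interior_iff_mem_nhds]
    filter_upwards [hg.continuousAt.eventually_lt_const h, hU.mem_nhds hxU] with y hy hyU
    have : y ∈ S ∩ U := by rw [hSU]; exact ⟨hyU, hy.le⟩
    exact this.1
  have hline : HasDerivAt (fun t : ℝ => x + t • w) w 0 := by
    simpa using ((hasDerivAt_id (0 : ℝ)).smul_const w).const_add x
  have hder : HasDerivAt (fun t : ℝ => g (x + t • w)) (fderiv ℝ g x w) 0 := by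
    refine HasFDerivAt.comp_hasDerivAt (𝕜 := ℝ) (x := 0) (l := g) ?_ hline
    simpa using hg.hasFDerivAt
  have h1 : ∀ᶠ t : ℝ in 𝓝[>] 0, g (x + t • w) < 0 := by
    have h := hder.tendsto_slope_zero_right.eventually_lt_const hw
    filter_upwards [h, self_mem_nhdsWithin] with t ht htpos
    simp only [zero_add, zero_smul, add_zero, hgx, sub_zero, smul_eq_mul] at ht
    have htpos' : 0 < t := htpos
    by_contra! hge
    have : 0 ≤ t⁻¹ * g (x + t • w) := by positivity
    linarith
  have h2 : ∀ᶠ t : ℝ in 𝓝[>] 0, x + t • w ∈ U :=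
    (hline.continuousAt.mono_left nhdsWithin_le_nhds).eventually
      (hU.mem_nhds (by simpa using hxU))
  obtain ⟨t, ⟨ht1, ht2⟩, ht⟩ := ((h1.and h2).and self_mem_nhdsWithin).exists
  have h3 : x + t • w ∈ S ∩ U := by rw [hSU]; exact ⟨ht2, ht1.le⟩
  have h4 := hν.2 _ h3.1
  rw [add_sub_cancel_left, inner_smul_right] at h4
  have ht' : 0 < t := ht
  by_contra! hpos
  nlinarith

/-- At a boundary point of a set with smooth boundary the outward normal is unique. -/
lemma IsOutwardNormal.unique {S : Set (Space m)} (hS : IsClosed S) (hC : HasC2Boundary S)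
    {x ν ν' : Space m} (hx : x ∈ frontier S) (hν : IsOutwardNormal S x ν)
    (hν' : IsOutwardNormal S x ν') : ν = ν' := by
  obtain ⟨U, hU, hxU, g, hg, hg0, hSU⟩ := hC x hx
  have hd : DifferentiableAt ℝ g x :=
    (hg.contDiffAt (hU.mem_nhds hxU)).differentiableAt (by norm_num)
  set n := (InnerProductSpace.toDual ℝ (Space m)).symm (fderiv ℝ g x) with hn
  have hin : ∀ w, fderiv ℝ g x w = inner ℝ n w := fun w =>
    (InnerProductSpace.toDual_symm_apply).symm
  have hn0 : n ≠ 0 := by simpa [hn] using hg0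
  have hnpos : 0 < ‖n‖ := norm_pos_iff.2 hn0
  have key : ∀ ν, IsOutwardNormal S x ν → ‖n‖ • ν = n := by
    intro ν hν
    have h1 : ∀ w, inner ℝ n w < 0 → inner ℝ ν w ≤ 0 := fun w hw =>
      inner_nonpos_of_fderiv_neg hS hU hxU hd hSU hx hν (by rwa [hin])
    by_contra hne
    have hlt : inner ℝ ν n < ‖ν‖ * ‖n‖ :=
      lt_of_le_of_ne (real_inner_le_norm _ _) fun h =>
        hne (by rw [inner_eq_norm_mul_iff_real] at h; rw [h, hν.1, one_smul])
    rw [hν.1, one_mul] at hlt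
    -- If `ν` is not parallel to the gradient `n`, this vector decreases `g` but has positive inner
    -- product with `ν`.
    have h2 := h1 (‖n‖ • ν - n) (by
      rw [inner_sub_right, inner_smul_right, real_inner_self_eq_norm_sq, real_inner_comm]
      nlinarith)
    rw [inner_sub_right, inner_smul_right, real_inner_self_eq_norm_sq, hν.1] at h2
    linarith
  have h := (key ν hν).trans (key ν' hν').symm
  exact smul_right_injective _ hnpos.ne' h

/-- A half-line that does not enter a smooth convex body makes an acute angle with the normal. -/
lemma inner_nonneg_of_segment_disjoint {S : Set (Space m)} (hS : IsClosed S)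
    (hconv : Convex ℝ S) (hint : (interior S).Nonempty) (hC : HasC2Boundary S)
    {x y ν : Space m} (hx : x ∈ frontier S) (hν : IsOutwardNormal S x ν)
    (hseg : Disjoint (interior S) (segment ℝ x y)) : 0 ≤ inner ℝ ν (y - x) := by
  have hxS : x ∈ S := hS.frontier_subset hx
  -- The separating functional is itself a multiple of an outward normal at `x`; uniqueness
  -- identifies that normal with `ν`.
  obtain ⟨f, u, hf, hf'⟩ := geometric_hahn_banach_open hconv.interior isOpen_interior
    (convex_segment x y) hseg
  have hcl : ∀ z ∈ S, f z ≤ u := by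
    intro z hz
    have h1 : z ∈ closure (interior S) := by
      rw [hconv.closure_interior_eq_closure_of_nonempty_interior hint]
      exact subset_closure hz
    exact closure_minimal (fun z hz => (hf z hz).le)
      (isClosed_le f.continuous continuous_const) h1
  have hfx : f x = u := le_antisymm (hcl x hxS) (hf' x (left_mem_segment ℝ x y))
  set n := (InnerProductSpace.toDual ℝ (Space m)).symm f with hn
  have hin : ∀ w, inner ℝ n w = f w := fun w => InnerProductSpace.toDual_symm_apply
  have hn0 : n ≠ 0 := by
    intro h
    obtain ⟨z, hz⟩ := hint
    have h1 := hf z hz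
    rw [← hfx, ← hin, ← hin, h] at h1
    simp at h1
  have hnpos : 0 < ‖n‖ := norm_pos_iff.2 hn0
  have hν' : IsOutwardNormal S x (‖n‖⁻¹ • n) := by
    refine ⟨by rw [norm_smul, norm_inv, norm_norm, inv_mul_cancel₀ hnpos.ne'], fun z hz => ?_⟩
    rw [inner_smul_left, hin, map_sub, hfx]
    exact mul_nonpos_of_nonneg_of_nonpos (by simp) (by linarith [hcl z hz])
  rw [hν.unique hS hC hx hν', inner_smul_left, hin, map_sub, hfx]
  exact mul_nonneg (by simp) (by linarith [hf' y (right_mem_segment ℝ x y)])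

lemma lifted_eq_preimage (a : Label m N) :
    lifted O a = (Homeomorph.subRight (latticeVec a.1)) ⁻¹' O a.2 := by
  ext z
  exact mem_lifted

lemma hasC2Boundary_lifted (hO : IsObstacleFamily O) (a : Label m N) :
    HasC2Boundary (lifted O a) := by
  intro x hx
  rw [lifted_eq_preimage, ← Homeomorph.preimage_frontier] at hx
  obtain ⟨U, hU, hxU, g, hg, hg0, hSU⟩ := hO.c2_boundary _ _ hx
  set v := latticeVec a.1 with hv
  refine ⟨(fun z => z - v) ⁻¹' U, hU.preimage (by fun_prop), hxU, fun z => g (z - v), ?_, ?_, ?_⟩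
  · exact hg.comp (by fun_prop) fun z hz => hz
  · rw [fderiv_comp_sub]
    exact hg0
  · ext z
    have := Set.ext_iff.1 hSU (z - v)
    simpa [mem_lifted] using this

lemma nonempty_interior_lifted (hO : IsObstacleFamily O) (a : Label m N) :
    (interior (lifted O a)).Nonempty := by
  rw [lifted_eq_preimage, ← Homeomorph.preimage_interior]
  exact (hO.interior_nonempty _).preimage (Homeomorph.surjective _)

/-- The direction of a trajectory turns away from the obstacle at a reflection. -/
lemma inner_direction_sub_nonneg_of_reflects (hO : IsObstacleFamily O) {a : Label m N}
    {x₀ x w y : Space m} (hx : x ∈ frontier (lifted O a)) (hseg : segment ℝ x₀ x ⊆ domain O)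
    (hr : Reflects (lifted O a) x (direction x₀ x) w) (hy : y ∈ lifted O a) :
    0 ≤ inner ℝ (direction x₀ x - w) (y - x) := by
  obtain ⟨ν, hν, rfl⟩ := hr
  have h1 : 0 ≤ inner ℝ ν (x₀ - x) := by
    refine inner_nonneg_of_segment_disjoint (hO.isCompact_lifted a).isClosed (hO.convex_lifted a)
      (nonempty_interior_lifted hO a) (hasC2Boundary_lifted hO a) hx hν ?_
    rw [Set.disjoint_left]
    intro z hz hz'
    rw [segment_symm] at hz'
    exact (mem_domain_iff hO).1 (hseg hz') a hz
  have h2 : inner ℝ (direction x₀ x) ν ≤ 0 := by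
    rw [direction, inner_smul_left, real_inner_comm, ← neg_sub, inner_neg_right]
    exact mul_nonpos_of_nonneg_of_nonpos (by simp) (by linarith)
  rw [sub_sub_cancel, inner_smul_left]
  simp only [conj_trivial]
  exact mul_nonneg_of_nonpos_of_nonpos (by linarith) (hν.2 y hy)

lemma norm_direction_le (x y : Space m) : ‖direction x y‖ ≤ 1 := by
  rcases eq_or_ne x y with rfl | h
  · simp [direction]
  · exact (norm_direction h).le

lemma pathLength_succ (x : ℕ → Space m) (n : ℕ) :
    pathLength x (n + 1) = pathLength x n + dist (x n) (x (n + 1)) :=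
  Finset.sum_range_succ _ _

/-- A trajectory piece is, up to a constant, a shortest path via its obstacles. -/
lemma pathLength_le_of_trajectory (hO : IsObstacleFamily O) {p : ℕ} {s : ℕ → Label m N}
    {x y : ℕ → Space m} (hx : IsTrajectoryOfType O (p + 1 : ℕ) s x)
    (hy : ∀ n ≤ p + 1, y n ∈ lifted O (s n)) :
    pathLength x (p + 1) ≤ pathLength y (p + 1) + 2 := by
  have hxm : ∀ n ≤ p + 1, x n ∈ lifted O (s n) := fun n hn =>
    (hO.isCompact_lifted _).isClosed.frontier_subset (hx.mem_frontier n (by exact_mod_cast hn))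
  -- Subgradient inequality for the distance. Summed over `n`, the linear terms at each reflection
  -- have a favourable sign, and the two ends cost at most 1 each.
  have hstep : ∀ n, dist (x n) (x (n + 1)) + inner ℝ (direction (x n) (x (n + 1)))
      (y (n + 1) - x (n + 1)) - inner ℝ (direction (x n) (x (n + 1))) (y n - x n) ≤
      dist (y n) (y (n + 1)) := by
    intro n
    set v := direction (x n) (x (n + 1)) with hv
    have h1 : inner ℝ v (x (n + 1) - x n) = dist (x n) (x (n + 1)) := by
      rcases eq_or_ne (x n) (x (n + 1)) with h | h
      · simp [h]
      · rw [← dist_smul_direction, inner_smul_right, ← hv, real_inner_self_eq_norm_sq, hv,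
          norm_direction h]
        simp
    have h2 : inner ℝ v (y (n + 1) - y n) ≤ dist (y n) (y (n + 1)) := by
      rw [dist_comm, dist_eq_norm]
      refine (real_inner_le_norm _ _).trans ?_
      exact mul_le_of_le_one_left (norm_nonneg _) (norm_direction_le _ _)
    rw [inner_sub_right] at h1 h2
    rw [inner_sub_right, inner_sub_right]
    linarith
  have hend : ∀ n ≤ p + 1, ∀ z w, |inner ℝ (direction z w) (y n - x n)| ≤ 1 := by
    intro n hn z w
    refine (abs_real_inner_le_norm _ _).trans ?_
    have h1 := hO.dist_le_one (hy n hn) (hxm n hn)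
    rw [dist_eq_norm] at h1
    exact mul_le_one₀ (norm_direction_le _ _) (norm_nonneg _) h1
  have key : ∀ n ≤ p, pathLength x (n + 1) + inner ℝ (direction (x n) (x (n + 1)))
      (y (n + 1) - x (n + 1)) ≤ pathLength y (n + 1) + 1 := by
    intro n hn
    induction n with
    | zero =>
      have h1 := hstep 0
      have h2 := (abs_le.1 (hend 0 (by omega) (x 0) (x 1))).2
      simp only [pathLength, zero_add, Finset.sum_range_one] at h1 ⊢
      linarith
    | succ n ih =>
      have h1 := hstep (n + 1)
      have h2 := ih (by omega)
      have h3 := inner_direction_sub_nonneg_of_reflects hO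
        (hx.mem_frontier (n + 1) (by exact_mod_cast (by omega : n + 1 ≤ p + 1)))
        (hx.segment_subset n (by exact_mod_cast (by omega : n < p + 1)))
        (hx.reflects n (by exact_mod_cast (by omega : n + 1 < p + 1))) (hy (n + 1) (by omega))
      rw [inner_sub_left] at h3
      rw [pathLength_succ x, pathLength_succ y]
      rw [show n + 1 + 1 = n + 2 from rfl] at h1 ⊢
      linarith
  have h1 := key p le_rfl
  have h2 := (abs_le.1 (hend (p + 1) le_rfl (x p) (x (p + 1)))).1
  linarith

/-! ### Rotation vectors -/

/-- The mean growth of a sequence that is periodic up to translation. -/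
lemma tendsto_inv_smul_of_add_period {E : Type*} [NormedAddCommGroup E] [NormedSpace ℝ E]
    {f : ℕ → E} {q : ℕ} (hq : 0 < q) {w : E} (hf : ∀ n, f (n + q) = f n + w) :
    Tendsto (fun n : ℕ => (n : ℝ)⁻¹ • f n) atTop (𝓝 ((q : ℝ)⁻¹ • w)) := by
  have hq' : (q : ℝ) ≠ 0 := by positivity
  -- Removing the linear drift leaves a periodic, hence bounded, sequence.
  let g : ℕ → E := fun n => f n - ((n : ℝ) * (q : ℝ)⁻¹) • w
  have hg : Function.Periodic g q := by
    intro n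
    simp only [g, hf, Nat.cast_add, add_mul, mul_inv_cancel₀ hq', add_smul, one_smul]
    abel
  have hbound : ∀ n, ‖g n‖ ≤ ∑ j ∈ Finset.range q, ‖g j‖ := by
    intro n
    rw [← hg.map_mod_nat n]
    exact Finset.single_le_sum (f := fun j => ‖g j‖) (fun _ _ => norm_nonneg _)
      (Finset.mem_range.2 (Nat.mod_lt _ hq))
  have h0 : Tendsto (fun n : ℕ => (n : ℝ)⁻¹ • g n) atTop (𝓝 0) :=
    Filter.Tendsto.zero_smul_isBoundedUnder_le tendsto_inv_atTop_nhds_zero_nat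
      (isBoundedUnder_of ⟨_, hbound⟩)
  have h1 := h0.add_const ((q : ℝ)⁻¹ • w)
  rw [zero_add] at h1
  refine h1.congr' ?_
  filter_upwards [eventually_gt_atTop 0] with n hn
  have hn' : (n : ℝ) ≠ 0 := by positivity
  simp only [g, smul_sub, smul_smul, inv_mul_cancel_left₀ hn', sub_add_cancel]

lemma pathLength_add_period {x : ℕ → Space m} {q : ℕ} {K : Fin m → ℤ}
    (hx : ∀ n, x (n + q) = x n + latticeVec K) (n : ℕ) :
    pathLength x (n + q) = pathLength x n + pathLength x q := by
  rw [pathLength, Finset.sum_range_add, pathLength, pathLength,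
    sum_range_add_of_periodic (f := fun j => dist (x j) (x (j + 1))) (dist_periodic hx)]

lemma pathLength_mono (x : ℕ → Space m) : Monotone (pathLength x) :=
  monotone_nat_of_le_succ fun n => by
    rw [pathLength_succ]; linarith [dist_nonneg (x := x n) (y := x (n + 1))]

lemma pathLength_pos {x : ℕ → Space m} (h : x 0 ≠ x 1) {q : ℕ} (hq : 0 < q) :
    0 < pathLength x q := by
  have h1 := pathLength_mono x hq
  have h2 : pathLength x 1 = dist (x 0) (x 1) := by simp [pathLength]
  exact (dist_pos.2 h).trans_le (h2 ▸ h1)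

lemma tendsto_pathLength_div {x : ℕ → Space m} {q : ℕ} (hq : 0 < q) {K : Fin m → ℤ}
    (hx : ∀ n, x (n + q) = x n + latticeVec K) :
    Tendsto (fun n : ℕ => (n : ℝ)⁻¹ * pathLength x n) atTop
      (𝓝 ((q : ℝ)⁻¹ * pathLength x q)) :=
  tendsto_inv_smul_of_add_period hq (pathLength_add_period hx)

lemma tendsto_pathLength_atTop {x : ℕ → Space m} (h : x 0 ≠ x 1) (hx : IsPeriodicOnTorus x) :
    Tendsto (pathLength x) atTop atTop := by
  obtain ⟨q, hq, K, hK⟩ := hx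
  have hpos := pathLength_pos h hq
  have h1 := Tendsto.atTop_mul_pos (by positivity) tendsto_natCast_atTop_atTop
    (tendsto_pathLength_div hq hK)
  refine h1.congr' ?_
  filter_upwards [eventually_gt_atTop 0] with n hn
  have hn' : (n : ℝ) ≠ 0 := by positivity
  rw [mul_inv_cancel_left₀ hn']

lemma isRotationVector_of_periodic {x : ℕ → Space m} (h : x 0 ≠ x 1) {q : ℕ} (hq : 0 < q)
    {K : Fin m → ℤ} (hx : ∀ n, x (n + q) = x n + latticeVec K) :
    IsRotationVector x ((pathLength x q)⁻¹ • latticeVec K) := by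
  have hpos := pathLength_pos h hq
  have hq' : (q : ℝ) ≠ 0 := by positivity
  have h1 := (tendsto_pathLength_div hq hx).inv₀ (by positivity)
  have h2 : Tendsto (fun n : ℕ => (n : ℝ)⁻¹ • (x n - x 0)) atTop
      (𝓝 ((q : ℝ)⁻¹ • latticeVec K)) :=
    tendsto_inv_smul_of_add_period hq fun n => by rw [hx]; abel
  have h3 := h1.smul h2
  rw [smul_smul, mul_inv, inv_inv, mul_right_comm, mul_inv_cancel₀ hq', one_mul] at h3
  refine h3.congr' ?_
  filter_upwards [eventually_gt_atTop 0] with n hn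
  have hn' : (n : ℝ) ≠ 0 := by positivity
  rw [meanDisplacement, smul_smul, mul_inv, inv_inv, mul_right_comm, mul_inv_cancel₀ hn', one_mul]

lemma IsAdmissible.visible {p : ℕ} {s : ℕ → Label m N} (h : IsAdmissible O p s) {n : ℕ}
    (hn : n < p) : Visible O (s n) (s (n + 1)) :=
  ⟨h.ne n (by exact_mod_cast hn), h.unobstructed n (by exact_mod_cast hn)⟩

lemma IsAdmissible.passes {p : ℕ} {s : ℕ → Label m N} (h : IsAdmissible O p s) {n : ℕ}
    (hn : n + 1 < p) : Passes O (s n) (s (n + 1)) (s (n + 2)) :=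
  ⟨h.visible (by omega), h.visible hn, h.not_between n (by exact_mod_cast hn)⟩

lemma isAdmissible_top {s : ℕ → Label m N} (h0 : (s 0).1 = 0)
    (h : ∀ n, Passes O (s n) (s (n + 1)) (s (n + 2))) : IsAdmissible O ⊤ s :=
  ⟨h0, fun n _ => (h n).fst.1, fun n _ => (h n).fst.2, fun n _ => (h n).not_between⟩

lemma IsAdmissible.of_top {s : ℕ → Label m N} (h : IsAdmissible O ⊤ s) (p : ℕ) :
    IsAdmissible O p s :=
  ⟨h.start, fun n _ => h.ne n (ENat.natCast_lt_top _), fun n _ => h.unobstructed n (ENat.natCast_lt_top _),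
    fun n _ => h.not_between n (ENat.natCast_lt_top _)⟩

lemma IsTrajectoryOfType.of_top {s : ℕ → Label m N} {x : ℕ → Space m}
    (h : IsTrajectoryOfType O ⊤ s x) (p : ℕ) : IsTrajectoryOfType O p s x :=
  ⟨fun n _ => h.mem_frontier n le_top, fun n _ => h.segment_subset n (ENat.natCast_lt_top _),
    fun n _ => h.reflects n (ENat.natCast_lt_top _)⟩

lemma periodicRotationVectors_subset (hm : 2 ≤ m) (hO : IsObstacleFamily O) :
    periodicRotationVectors O ⊆ admissibleRotationSet O := by
  rintro v ⟨s, x, hs, hx, hper, hv⟩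
  refine ⟨fun n => n, fun _ => s, fun _ => x, fun n => ⟨hs.of_top n, hx.of_top n⟩,
    tendsto_pathLength_atTop ?_ hper, Tendsto.mapClusterPt hv⟩
  have hmem : ∀ n, x n ∈ lifted O (s n) := fun n =>
    (hO.isCompact_lifted _).isClosed.frontier_subset (hx.mem_frontier n le_top)
  intro h
  exact (hO.disjoint_lifted hm (hs.ne 0 (ENat.natCast_lt_top _))).le_bot ⟨hmem 1, h ▸ hmem 0⟩

/-! ### Closing a piece and approximating its mean displacement -/

/-- A trajectory piece can be closed up with a bounded change of its length and displacement. -/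
lemma exists_periodic_closing (hm : 2 ≤ m) (hO : IsObstacleFamily O) :
    ∃ C, ∀ (p : ℕ) (s : ℕ → Label m N) (x : ℕ → Space m), IsAdmissible O (p + 1 : ℕ) s →
      IsTrajectoryOfType O (p + 1 : ℕ) s x → ∃ (K : Fin m → ℤ) (L : ℝ), 0 < L ∧
        L⁻¹ • latticeVec K ∈ periodicRotationVectors O ∧ ‖latticeVec K‖ ≤ L ∧
        |L - pathLength x (p + 1)| ≤ C ∧ ‖x (p + 1) - x 0 - latticeVec K‖ ≤ C := by
  choose c hc using fun r => hO.nonempty r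
  obtain ⟨C, hC⟩ := exists_periodic_extension hm hO c
  refine ⟨C + 2, fun p s x hs hx => ?_⟩
  obtain ⟨l, K, s', hl, hs', hper, hpass, hsum⟩ :=
    hC s p (fun n hn => hs.visible (by omega)) (fun n hn => hs.passes (by omega))
  have hC0 : 0 ≤ C := le_trans (Finset.sum_nonneg fun _ _ => dist_nonneg) hsum
  have hrep : ∀ a, rep c a ∈ lifted O a := fun a => ⟨_, hc _, rfl⟩
  have hxm : ∀ n ≤ p + 1, x n ∈ lifted O (s' n) := fun n hn => by
    rw [hs' n hn]
    exact (hO.isCompact_lifted _).isClosed.frontier_subset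
      (hx.mem_frontier n (by exact_mod_cast hn))
  obtain ⟨z, hz, hzmin⟩ := exists_shortest_periodicPath hO hc hper
  have htraj := isTrajectoryOfType_of_isMinOn hm hO (by omega) hper hpass hz hzmin
  have hz01 : z 0 ≠ z 1 := fun h =>
    (hO.disjoint_lifted hm (hpass 0).fst.1).le_bot ⟨hz.1 1, h ▸ hz.1 0⟩
  have hzK : z (p + 1 + l) - z 0 = latticeVec K := by
    have := hz.2 0
    rw [zero_add] at this
    rw [this, add_sub_cancel_left]
  refine ⟨K, pathLength z (p + 1 + l), pathLength_pos hz01 (by omega), ?_, ?_, ?_, ?_⟩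
  · refine ⟨s', z, isAdmissible_top ?_ hpass, htraj, ⟨_, by omega, K, hz.2⟩,
      isRotationVector_of_periodic hz01 (by omega) hz.2⟩
    rw [hs' 0 (by omega), hs.start]
  · rw [← hzK, ← dist_eq_norm, dist_comm]
    exact dist_le_range_sum_dist z _
  · have hlow : pathLength x (p + 1) ≤ pathLength z (p + 1) + 2 :=
      pathLength_le_of_trajectory hO hx fun n hn => by rw [← hs' n hn]; exact hz.1 n
    have hmono : pathLength z (p + 1) ≤ pathLength z (p + 1 + l) := pathLength_mono z (by omega)
    -- The competitor follows the given piece and then the representatives of the closing labels;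
    -- minimality of `z` bounds its length from above.
    obtain ⟨y, hy, hyt⟩ := exists_periodicPath_extending (O := O) (by omega) hper
      (t := fun n => if n ≤ p + 1 then x n else rep c (s' n)) (fun n _ => by
        split_ifs with h
        · exact hxm n h
        · exact hrep _)
    have hyx : ∀ n ≤ p + 1, y n = x n := fun n hn => by
      rw [hyt n (by omega), if_pos hn]
    have hyrep : ∀ n, p + 1 < n → n < p + 1 + l → dist (y n) (rep c (s' n)) = 0 :=
      fun n hn hn' => by rw [hyt n hn', if_neg (by omega), dist_self]
    have hup : pathLength y (p + 1 + l) ≤ pathLength x (p + 1) + (1 + C + 1) := by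
      rw [pathLength, Finset.sum_range_add]
      refine add_le_add (le_of_eq (Finset.sum_congr rfl fun j hj => ?_)) ?_
      · rw [Finset.mem_range] at hj
        rw [hyx j (by omega), hyx (j + 1) (by omega)]
      -- On the closing part the competitor differs from the representatives only at its two ends,
      -- the second being the translate of `x 0`.
      have h1 : ∑ j ∈ Finset.range l, dist (y (p + 1 + j)) (rep c (s' (p + 1 + j))) ≤ 1 := by
        rw [Finset.sum_eq_single_of_mem 0 (by simpa using hl) fun j hj hj0 =>
          hyrep _ (by omega) (by rw [Finset.mem_range] at hj; omega)]
        exact hO.dist_le_one (hy.1 _) (hrep _)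
      have h2 : ∑ j ∈ Finset.range l, dist (rep c (s' (p + 1 + j + 1))) (y (p + 1 + j + 1)) ≤
          1 := by
        rw [Finset.sum_eq_single_of_mem (l - 1) (by simpa using hl) fun j hj hj0 => by
          rw [dist_comm]
          exact hyrep _ (by omega) (by rw [Finset.mem_range] at hj; omega)]
        exact hO.dist_le_one (hrep _) (hy.1 _)
      refine le_trans (Finset.sum_le_sum fun j _ => dist_triangle4 (y (p + 1 + j))
        (rep c (s' (p + 1 + j))) (rep c (s' (p + 1 + j + 1))) (y (p + 1 + j + 1))) ?_
      rw [Finset.sum_add_distrib, Finset.sum_add_distrib]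
      linarith
    have hle := hzmin y hy
    rw [abs_le]
    constructor <;> linarith
  · have h1 : dist (rep c (s' (p + 1))) (rep c (s' (p + 1 + l))) ≤ C :=
      (dist_le_range_sum_dist (fun j => rep c (s' (p + 1 + j))) l).trans hsum
    have h2 := hO.dist_le_one (hxm (p + 1) le_rfl) (hrep _)
    have h3 := hO.dist_le_one (hrep _) (hxm 0 (by omega))
    have h4 : rep c (s' (p + 1 + l)) = rep c (s' 0) + latticeVec K := by
      rw [← rep_shift, ← hper 0, zero_add]
    rw [h4, dist_eq_norm] at h1
    rw [dist_eq_norm] at h2 h3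
    have he : x (p + 1) - x 0 - latticeVec K = (x (p + 1) - rep c (s' (p + 1))) +
        (rep c (s' (p + 1)) - (rep c (s' 0) + latticeVec K)) + (rep c (s' 0) - x 0) := by abel
    rw [he]
    refine (norm_add₃_le).trans ?_
    linarith

lemma admissibleRotationSet_subset (hm : 2 ≤ m) (hO : IsObstacleFamily O) :
    admissibleRotationSet O ⊆ closure (periodicRotationVectors O) := by
  rintro v ⟨p, s, x, hsx, hlen, hv⟩
  obtain ⟨C, hC⟩ := exists_periodic_closing hm hO
  rw [Metric.mem_closure_iff]
  intro ε hε
  have h1 : ∃ᶠ n in atTop, dist v (meanDisplacement (x n) (p n)) < ε / 2 := by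
    have h := mapClusterPt_iff_frequently.1 hv _ (Metric.ball_mem_nhds v (half_pos hε))
    exact h.mono fun n hn => by rwa [dist_comm]
  obtain ⟨n, hn, hτ⟩ := (h1.and_eventually
    -- Closing changes the quotient by at most `2 * C` over the length, which must be below `ε / 2`.
    ((hlen.eventually_gt_atTop (4 * C / ε)).and (hlen.eventually_gt_atTop 0))).exists
  have hp : p n ≠ 0 := by
    intro h
    rw [h] at hτ
    simp [pathLength] at hτ
  obtain ⟨p', hp'⟩ := Nat.exists_eq_succ_of_ne_zero hp
  obtain ⟨hs, hx⟩ := hsx n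
  rw [hp'] at hs hx hn hτ
  obtain ⟨K, L, hL, hmem, hKL, hLC, hKC⟩ := hC p' (s n) (x n) hs hx
  refine ⟨_, hmem, ?_⟩
  set τ := pathLength (x n) (p' + 1) with hτdef
  have hτ0 : 0 < τ := hτ.2
  have hd : dist (meanDisplacement (x n) (p' + 1)) (L⁻¹ • latticeVec K) ≤ τ⁻¹ * (C + C) := by
    -- The error splits into that of the displacement and that of the length; `‖latticeVec K‖ ≤ L`
    -- bounds the latter by `C`.
    have he : meanDisplacement (x n) (p' + 1) - L⁻¹ • latticeVec K =
        τ⁻¹ • ((x n (p' + 1) - x n 0 - latticeVec K) + ((L - τ) / L) • latticeVec K) := by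
      rw [meanDisplacement, ← hτdef, smul_add, smul_smul, smul_sub _ (_ - _)]
      have : τ⁻¹ * ((L - τ) / L) = τ⁻¹ - L⁻¹ := by field_simp
      rw [this, sub_smul]
      abel
    rw [dist_eq_norm, he, norm_smul, Real.norm_eq_abs, abs_of_pos (inv_pos.2 hτ0)]
    gcongr
    refine (norm_add_le _ _).trans (add_le_add hKC ?_)
    rw [norm_smul, norm_div, Real.norm_eq_abs, Real.norm_eq_abs, abs_of_pos hL, div_mul_eq_mul_div,
      div_le_iff₀ hL]
    exact mul_le_mul hLC hKL (norm_nonneg _) ((abs_nonneg _).trans hLC)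
  have h2 : τ⁻¹ * (C + C) < ε / 2 := by
    have h3 := hτ.1
    rw [div_lt_iff₀ hε] at h3
    rw [inv_mul_lt_iff₀ hτ0]
    linarith
  calc dist v (L⁻¹ • latticeVec K)
      ≤ dist v (meanDisplacement (x n) (p' + 1)) +
        dist (meanDisplacement (x n) (p' + 1)) (L⁻¹ • latticeVec K) := dist_triangle _ _ _
    _ < ε / 2 + ε / 2 := add_lt_add_of_lt_of_le hn (hd.trans h2.le)
    _ = ε := add_halves ε

end TorusBilliard

end

theorem mainTheorem2 {m N : ℕ} (hm : 2 ≤ m)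
    (O : Fin N → Set (TorusBilliard.Space m)) (hO : TorusBilliard.IsObstacleFamily O) :
    TorusBilliard.periodicRotationVectors O ⊆ TorusBilliard.admissibleRotationSet O ∧
      TorusBilliard.admissibleRotationSet O ⊆
        closure (TorusBilliard.periodicRotationVectors O) := by
  exact ⟨TorusBilliard.periodicRotationVectors_subset hm hO,
    TorusBilliard.admissibleRotationSet_subset hm hO⟩
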